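/- **Conventions.** Let $K$ be an algebraically closed field. For a finite-dimensional $K$-algebra $A$, $\operatorname{mod} A$ is the category of finitely generated (left) $A$-modules, and $K_0(A)$ is its Grothendieck group: the abelian group generated by the objects of $\operatorname{mod} A$ with a relation $[Y]=[X]+[Z]$ for every short exact sequence $0\to X\to Y\to Z\to 0$ in $\operatorname{mod} A$. A *stratifying system* of size $t$ in $\operatorname{mod} A$ is a family $\theta_1,\dots,\theta_t$ of indecomposable objects of $\operatorname{mod} A$ together with a linear order $\le$ on $\{1,\dots,t\}$ such that $\operatorname{Hom}_A(\theta_j,\theta_i)=0$ whenever $i<j$ and $\operatorname{Ext}^1_A(\theta_j,\theta_i)=0$ whenever $i\le j$. A module $M\in\operatorname{mod} A$ is *$2$-cluster-tilting* if $$\operatorname{add}M=\{X\in\operatorname{mod}A:\operatorname{Ext}^1_A(X,Y)=0\ \forall\, Y\in\operatorname{add}M\}=\{X\in\operatorname{mod}A:\operatorname{Ext}^1_A(Y,X)=0\ \forall\, Y\in\operatorname{add}M\},$$ where $\operatorname{add}M$ consists of the direct summands of finite direct sums of copies of $M$. The *Auslander algebra* of a $K$-algebra $H$ with only finitely many isomorphism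 classes of indecomposable finitely generated modules is $\operatorname{End}_H(X_1\oplus\dots\oplus X_s)^{\mathrm{op}}$, where $X_1,\dots,X_s$ represent these classes, each once. **Theorem.** For every integer $m\ge 1$, put $n=3m-1$. There is a finite-dimensional basic $K$-algebra $A_m$ which is (isomorphic to) the Auslander algebra of the path algebra over $K$ of the linearly oriented quiver $1\to 2\to\cdots\to n$ of type $\mathbb A_n$, and there are modules $\theta_1,\dots,\theta_{t_m}$ in $\operatorname{mod}A_m$ and a linear order $\le$ on $\{1,\dots,t_m\}$ such that: 1. $((\theta_i)_i,\le)$ is a stratifying system of size $t_m$ in $\operatorname{mod}A_m$; 2. $M=\theta_1\oplus\dots\oplus\theta_{t_m}$ is a $2$-cluster-tilting $A_m$-module; 3. whenever there is an arrow $i\to j$ in the quiver of $\operatorname{End}_{A_m}(M)$, that is, whenever $e_j(J/J^2)e_i\ne 0$ where $J$ is the Jacobson radical of $\operatorname{End}_{A_m}(M)$ and $e_i$ is the projection onto $\theta_i$, then $i<j$; in particular this quiver is acyclic; 4. $t_m=\dfrac{n(n+1)(n+2)}{6}$, the group $K_0(A_m)$ is free of finite rank, and $\operatorname{rk}K_0(A_m)=\dfrac{n(n+1)}{2}$;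 5. $t_m>m\cdot\operatorname{rk}K_0(A_m)$. -/

import Mathlib

open CategoryTheory

universe u

/-! ### Path algebras of finite quivers -/

/-- The path algebra of the quiver `V` over `K`, as the space of families of formal `K`-linear
combinations of paths `a ⟶ ⋯ ⟶ b`, one for every pair of vertices `(a, b)`. For a quiver with
finitely many vertices this is the `K`-vector space with basis the set of all paths. -/
def PathAlgebra (K : Type u) (V : Type) [Quiver.{0} V] [Field K] : Type u :=
  ∀ a b : V, Quiver.Path a b →₀ K

namespace PathAlgebra

variable (K : Type u) (V : Type) [Quiver.{0} V] [Field K]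

noncomputable instance : AddCommGroup (PathAlgebra K V) :=
  inferInstanceAs (AddCommGroup (∀ a b : V, Quiver.Path a b →₀ K))

noncomputable instance : Module K (PathAlgebra K V) :=
  inferInstanceAs (Module K (∀ a b : V, Quiver.Path a b →₀ K))

variable {V}

/-- Bilinear extension of the concatenation of paths. -/
noncomputable def concat (a b c : V) :
    (Quiver.Path a b →₀ K) →ₗ[K] (Quiver.Path b c →₀ K) →ₗ[K] (Quiver.Path a c →₀ K) :=
  Finsupp.lsum K fun p => LinearMap.toSpanSingleton K _
    (Finsupp.lmapDomain K K fun q : Quiver.Path b c => p.comp q)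

theorem concat_single_single {a b c : V} (p : Quiver.Path a b) (q : Quiver.Path b c) (x y : K) :
    concat K a b c (Finsupp.single p x) (Finsupp.single q y) =
      Finsupp.single (p.comp q) (x * y) := by
  simp [concat, Finsupp.mapDomain_single]

theorem concat_assoc {a b c d : V} (x : Quiver.Path a b →₀ K) (y : Quiver.Path b c →₀ K)
    (z : Quiver.Path c d →₀ K) :
    concat K a c d (concat K a b c x y) z = concat K a b d x (concat K b c d y z) := by
  induction x using Finsupp.induction_linear with
  | zero => simp
  | add f g hf hg => simp [hf, hg]
  | single p r =>
    induction y using Finsupp.induction_linear with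
    | zero => simp
    | add f g hf hg => simp [hf, hg]
    | single q s =>
      induction z using Finsupp.induction_linear with
      | zero => simp
      | add f g hf hg => simp [hf, hg]
      | single w t => simp only [concat_single_single, mul_assoc, Quiver.Path.comp_assoc]

theorem nil_concat {a b : V} (x : Quiver.Path a b →₀ K) :
    concat K a a b (Finsupp.single Quiver.Path.nil 1) x = x := by
  induction x using Finsupp.induction_linear with
  | zero => simp
  | add f g hf hg => simp [hf, hg]
  | single p r => simp [concat_single_single]

theorem concat_nil {a b : V} (x : Quiver.Path a b →₀ K) :
    concat K a b b x (Finsupp.single Quiver.Path.nil 1) = x := by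
  induction x using Finsupp.induction_linear with
  | zero => simp
  | add f g hf hg => simp [hf, hg]
  | single p r => simp [concat_single_single]

variable {K}

theorem add_apply (x y : PathAlgebra K V) (a b : V) : (x + y) a b = x a b + y a b := rfl

theorem zero_apply (a b : V) : (0 : PathAlgebra K V) a b = 0 := rfl

theorem smul_apply (r : K) (x : PathAlgebra K V) (a b : V) : (r • x) a b = r • x a b := rfl

/-- The product of two paths is their concatenation if they can be composed and `0` otherwise,
extended bilinearly. -/
noncomputable instance [Fintype V] : Mul (PathAlgebra K V) :=
  ⟨fun x y a c => ∑ b, concat K a b c (x a b) (y b c)⟩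

theorem mul_apply [Fintype V] (x y : PathAlgebra K V) (a c : V) :
    (x * y) a c = ∑ b, concat K a b c (x a b) (y b c) := rfl

variable [DecidableEq V]

/-- The unit is the sum of all trivial paths. -/
noncomputable instance : One (PathAlgebra K V) :=
  ⟨fun a => Pi.single a (Finsupp.single (Quiver.Path.nil : Quiver.Path a a) 1)⟩

theorem one_apply_self (a : V) :
    (1 : PathAlgebra K V) a a = Finsupp.single Quiver.Path.nil 1 :=
  Pi.single_eq_same (M := fun b => Quiver.Path a b →₀ K) a _

theorem one_apply_ne {a b : V} (h : a ≠ b) : (1 : PathAlgebra K V) a b = 0 :=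
  Pi.single_eq_of_ne (M := fun b => Quiver.Path a b →₀ K) h.symm _

variable [Fintype V]

noncomputable instance : Ring (PathAlgebra K V) where
  __ := (inferInstance : AddCommGroup (PathAlgebra K V))
  left_distrib x y z := by
    funext a c; simp [mul_apply, add_apply, Finset.sum_add_distrib]
  right_distrib x y z := by
    funext a c; simp [mul_apply, add_apply, Finset.sum_add_distrib]
  zero_mul x := by funext a c; simp [mul_apply, zero_apply]
  mul_zero x := by funext a c; simp [mul_apply, zero_apply]
  mul_assoc x y z := by
    funext a d
    simp only [mul_apply, map_sum, LinearMap.sum_apply, concat_assoc]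
    exact Finset.sum_comm
  one_mul x := by
    funext a c
    rw [mul_apply, Finset.sum_eq_single a]
    · rw [one_apply_self, nil_concat]
    · intro b _ hb; rw [one_apply_ne hb.symm]; simp
    · simp
  mul_one x := by
    funext a c
    rw [mul_apply, Finset.sum_eq_single c]
    · rw [one_apply_self, concat_nil]
    · intro b _ hb; rw [one_apply_ne hb]; simp
    · simp

noncomputable instance : Algebra K (PathAlgebra K V) :=
  Algebra.ofModule
    (fun r x y => by funext a c; simp [mul_apply, smul_apply, Finset.smul_sum])
    (fun r x y => by funext a c; simp [mul_apply, smul_apply, Finset.smul_sum])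

end PathAlgebra

/-- The vertex set of the linearly oriented quiver `1 → 2 → ⋯ → n` of type `A_n`. -/
def LinearQuiver (n : ℕ) : Type := Fin n

namespace LinearQuiver

/-- There is exactly one arrow from each vertex to the next one, and no other arrow. -/
instance (n : ℕ) : Quiver.{0} (LinearQuiver n) :=
  ⟨fun i j => PLift (Fin.val (n := n) i + 1 = Fin.val (n := n) j)⟩

instance (n : ℕ) : Fintype (LinearQuiver n) := inferInstanceAs (Fintype (Fin n))

instance (n : ℕ) : DecidableEq (LinearQuiver n) := inferInstanceAs (DecidableEq (Fin n))

end LinearQuiver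

/-! ### Module categories -/

section Modules

/-- `A` is the (basic) Auslander algebra of the `K`-algebra `H`: there is a finite complete
irredundant list `X` of finitely generated indecomposable left `H`-modules, and `A` is isomorphic
as a `K`-algebra to the opposite of the endomorphism algebra of their direct sum. -/
def IsAuslanderAlgebra (K : Type u) [Field K] (H : Type u) [Ring H] [Algebra K H]
    (A : Type u) [Ring A] [Algebra K A] : Prop :=
  ∃ (s : ℕ) (X : Fin s → ModuleCat.{u} H),
    (∀ i, Module.Finite H (X i)) ∧
    (∀ i, Indecomposable (X i)) ∧
    (∀ i j, Nonempty (X i ≅ X j) → i = j) ∧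
    (∀ Y : ModuleCat.{u} H, Module.Finite H Y → Indecomposable Y → ∃ i, Nonempty (Y ≅ X i)) ∧
    ∃ φ : A ≃+* (Module.End H (∀ i, X i))ᵐᵒᵖ,
      ∀ (c : K) (x : ∀ i, X i), (φ (algebraMap K A c)).unop x = algebraMap K H c • x

variable {A : Type u} [Ring A]

variable (A) in
/-- `A` is basic: as a left module over itself it is a finite direct sum of pairwise
non-isomorphic indecomposable modules. -/
def IsBasicAlgebra : Prop :=
  ∃ (s : ℕ) (P : Fin s → ModuleCat.{u} A),
    (∀ i, Indecomposable (P i)) ∧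
    (∀ i j, Nonempty (P i ≅ P j) → i = j) ∧
    Nonempty (A ≃ₗ[A] ∀ i, P i)

/-- `Ext¹_A(X, Y) = 0`. -/
def ExtOneVanishes (X Y : ModuleCat.{u} A) : Prop :=
  Subsingleton (Abelian.Ext X Y 1)

/-- `X` lies in `add M`: it is a direct summand of a finite direct sum of copies of `M`. -/
def InAdd (M X : ModuleCat.{u} A) : Prop :=
  ∃ (k : ℕ) (i : X →ₗ[A] (Fin k → M)) (p : (Fin k → M) →ₗ[A] X), p ∘ₗ i = LinearMap.id

/-- The finitely generated module `M` is `2`-cluster-tilting: the finitely generated modules in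
`add M` are exactly those `X` with `Ext¹(X, Y) = 0` for all `Y` in `add M`, and exactly those `X`
with `Ext¹(Y, X) = 0` for all `Y` in `add M`. -/
def IsTwoClusterTilting (M : ModuleCat.{u} A) : Prop :=
  Module.Finite A M ∧ ∀ X : ModuleCat.{u} A, Module.Finite A X →
    (InAdd M X ↔ ∀ Y, InAdd M Y → ExtOneVanishes X Y) ∧
    (InAdd M X ↔ ∀ Y, InAdd M Y → ExtOneVanishes Y X)

/-- `(θ, ord)` is a stratifying system of size `t` in the category of finitely generated left
`A`-modules; `ord` is any linear order on the index set. -/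
structure IsStratifyingSystem {t : ℕ} (θ : Fin t → ModuleCat.{u} A)
    (ord : LinearOrder (Fin t)) : Prop where
  finite : ∀ i, Module.Finite A (θ i)
  indecomposable : ∀ i, Indecomposable (θ i)
  hom_eq_zero : ∀ i j, ord.lt i j → ∀ f : θ j ⟶ θ i, f = 0
  ext_vanishes : ∀ i j, ord.le i j → ExtOneVanishes (θ j) (θ i)

/-- The idempotent endomorphism of `⨁ θ` that projects onto the summand `θ i`. -/
noncomputable def summandIdempotent {t : ℕ} (θ : Fin t → ModuleCat.{u} A) (i : Fin t) :
    Module.End A (∀ k, θ k) :=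
  LinearMap.single A (fun k => θ k) i ∘ₗ LinearMap.proj i

/-- In the (Gabriel) quiver of the endomorphism algebra `E` of `⨁ θ`, whose vertices are the
indices of the summands, there is an arrow from `i` to `j`: with `J` the Jacobson radical of `E`,
the space `e_j (J / J²) e_i` of radical maps `θ i ⟶ θ j` modulo `J²` is nonzero. -/
def EndQuiverArrow {t : ℕ} (θ : Fin t → ModuleCat.{u} A) (i j : Fin t) : Prop :=
  ∃ f ∈ Ring.jacobson (Module.End A (∀ k, θ k)),
    summandIdempotent θ j * f * summandIdempotent θ i ∉
      Ring.jacobson (Module.End A (∀ k, θ k)) * Ring.jacobson (Module.End A (∀ k, θ k))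

/-! ### The Grothendieck group -/

variable (A) in
/-- The finitely generated left `A`-modules. -/
def FinGenModule : Type (u + 1) := {M : ModuleCat.{u} A // Module.Finite A M}

variable (A) in
/-- The subgroup generated by `[Y] - [X] - [Z]` for the short exact sequences `0 → X → Y → Z → 0`
of finitely generated modules. -/
def shortExactRelations : AddSubgroup (FreeAbelianGroup (FinGenModule A)) :=
  AddSubgroup.closure {x | ∃ (X Y Z : FinGenModule A) (f : X.1 →ₗ[A] Y.1) (g : Y.1 →ₗ[A] Z.1),
    Function.Injective f ∧ Function.Exact f g ∧ Function.Surjective g ∧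
    x = FreeAbelianGroup.of Y - FreeAbelianGroup.of X - FreeAbelianGroup.of Z}

variable (A) in
/-- The Grothendieck group `K₀(A)` of the category of finitely generated left `A`-modules. -/
abbrev GrothendieckK0 : Type (u + 1) :=
  FreeAbelianGroup (FinGenModule A) ⧸ shortExactRelations A

end Modules

/-!
The Auslander algebra of the linearly oriented quiver of type `A_n` is a category algebra whose
morphism spaces have dimension at most one. It has a basis of matrix units `e x y`, where `x` and
`y` run through the interval modules of the quiver and `e x y` exists if and only if there is a
nonzero map from the interval module `x` to the interval module `y`, and `e x y * e y z` is `e x z`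
or zero. Algebras of this kind, called thin algebras here, are set up for a general relation on the
vertices. A suitable set `S` of vertices supports a thin module, which has a copy of `K` at each
vertex of `S`; homomorphisms out of it and into it are given by elements and linear functionals that
are killed by certain matrix units (`ThinModule.lift`, `ThinModule.colift`). Thin modules with a
generator are bricks. A thin algebra is always basic, and if it has no oriented cycles its
Grothendieck group is free on the vertices, by dimension vectors (`ThinAlgebra.k0Equiv`).

The vertices of the Auslander algebra are the pairs `(a, b)` with `0 < a < b ≤ n + 1`. The summands
of the cluster tilting module are the thin modules `M_(i,j,k)` supported on the rectangles
`i < a ≤ j < b ≤ k`, one for every triple `0 ≤ i < j < k ≤ n + 1`; those with `i = 0` are the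
indecomposable projective modules. A nonzero homomorphism from one of them to another exists
only if the triple weakly increases in each entry, so the lexicographic order on triples makes them a stratifying
system once the extensions vanish, and since the summands are bricks the arrows of the quiver of
the endomorphism algebra go strictly up.

A projective presentation of `M_(i,j,k)` shows that `Ext¹(M_(i,j,k), X)` vanishes if and only if
the sequence `X_(j,k) → X_(i,k) → X_(i,j)` is exact. Say that `X` is middle exact if this holds for
all `0 < i < j < k`. The rectangle modules are middle exact. Conversely a nonzero middle exact
module of finite dimension has a rectangle module as a direct summand: this is
`ThinModule.MiddleExact.exists_retract_cell`, the central step, and by induction on the dimension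
the middle exact modules are exactly the sums of rectangle modules. This gives one half of the
cluster tilting property. For the other half, let `X` be a module without extensions by the
rectangle modules and take a right approximation of `X` by sums of rectangle modules. It is
surjective as the projective modules are among them, and its kernel is middle exact, so that it is
again a sum of rectangle modules; hence the approximation splits.

That the thin algebra of pairs is the Auslander algebra is checked directly: every nonzero module
over the path algebra has an interval module as a summand, and the homomorphisms between interval
modules are computed from their generators.
-/

set_option linter.unusedSectionVars false

/-! ### Thin algebras -/

/-- A relation `R` on a set of vertices for which the formal symbols `e x y`, one for every pair
with `R x y`, multiply associatively under `e x y * e y z = e x z`, where `e x z` is read as `0` if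
`R x z` fails. A vertex `x` with `¬ R x x` is related to nothing, so it plays no role. -/
class IsThinRel {V : Type} (R : V → V → Prop) : Prop where
  refl_left : ∀ {x y}, R x y → R x x
  refl_right : ∀ {x y}, R x y → R y y
  trans_left : ∀ {x y z w}, R x y → R y z → R z w → R x w → R x z
  trans_right : ∀ {x y z w}, R x y → R y z → R z w → R x w → R y w
  antisymm : ∀ {x y}, R x y → R y x → x = y

/-- The matrices with entries in `K` that are supported on `R`, as a subspace. -/
def thinMatrices (K : Type u) [Field K] {V : Type} (R : V → V → Prop) :
    Submodule K (V → V → K) where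
  carrier := {f | ∀ x y, ¬ R x y → f x y = 0}
  add_mem' hf hg x y h := by simp [hf x y h, hg x y h]
  zero_mem' _ _ _ := rfl
  smul_mem' c f hf x y h := by simp [hf x y h]

/-- The thin algebra of `R`: matrices supported on `R`, multiplied as matrices except that all
entries of the product outside of `R` are discarded. It is the category algebra of a `K`-linear
category whose morphism spaces have dimension at most one. -/
def ThinAlgebra (K : Type u) [Field K] {V : Type} (R : V → V → Prop) : Type u :=
  thinMatrices K R

namespace ThinAlgebra

variable {K : Type u} [Field K] {V : Type} {R : V → V → Prop}

noncomputable instance : AddCommGroup (ThinAlgebra K R) :=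
  inferInstanceAs (AddCommGroup (thinMatrices K R))

noncomputable instance : Module K (ThinAlgebra K R) :=
  inferInstanceAs (Module K (thinMatrices K R))

/-- The matrix with the given entries. -/
def mk (f : V → V → K) (hf : ∀ x y, ¬ R x y → f x y = 0) : ThinAlgebra K R := ⟨f, hf⟩

instance : FunLike (ThinAlgebra K R) V (V → K) where
  coe f := Subtype.val (p := (· ∈ thinMatrices K R)) f
  coe_injective := Subtype.val_injective

@[simp] theorem mk_apply (f : V → V → K) (hf : ∀ x y, ¬ R x y → f x y = 0) (x y : V) :
    mk f hf x y = f x y := rfl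

@[ext]
theorem ext {f g : ThinAlgebra K R} (h : ∀ x y, f x y = g x y) : f = g :=
  DFunLike.ext _ _ fun x => funext fun y => h x y

theorem apply_eq_zero (f : ThinAlgebra K R) {x y : V} (h : ¬ R x y) : f x y = 0 := f.2 x y h

theorem rel_of_apply_ne_zero {f : ThinAlgebra K R} {x y : V} (h : f x y ≠ 0) : R x y := by
  by_contra h'
  exact h (f.apply_eq_zero h')

@[simp] theorem add_apply (f g : ThinAlgebra K R) (x y : V) : (f + g) x y = f x y + g x y := rfl

@[simp] theorem zero_apply (x y : V) : (0 : ThinAlgebra K R) x y = 0 := rfl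

@[simp] theorem smul_apply (c : K) (f : ThinAlgebra K R) (x y : V) :
    (c • f) x y = c * f x y := rfl

@[simp] theorem sum_apply {ι : Type*} (s : Finset ι) (f : ι → ThinAlgebra K R) (x y : V) :
    (∑ i ∈ s, f i) x y = ∑ i ∈ s, f i x y := by
  classical
  induction s using Finset.induction_on with
  | empty => simp
  | insert a s ha ih => simp [Finset.sum_insert ha, ih]

variable [Fintype V]

instance : Module.Finite K (ThinAlgebra K R) :=
  inferInstanceAs (Module.Finite K (thinMatrices K R))

open Classical in
noncomputable instance : Mul (ThinAlgebra K R) :=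
  ⟨fun f g => mk (fun x z => if R x z then ∑ y, f x y * g y z else 0) fun _ _ h => if_neg h⟩

open Classical in
noncomputable instance [IsThinRel R] : One (ThinAlgebra K R) :=
  ⟨mk (fun x y => if x = y ∧ R x y then 1 else 0) fun _ _ h => if_neg fun h' => h h'.2⟩

theorem mul_apply_of_rel (f g : ThinAlgebra K R) {x z : V} (h : R x z) :
    (f * g) x z = ∑ y, f x y * g y z := if_pos h

open Classical in
theorem one_apply [IsThinRel R] (x y : V) :
    (1 : ThinAlgebra K R) x y = if x = y ∧ R x y then 1 else 0 := rfl

variable [IsThinRel R]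

protected theorem mul_assoc (f g h : ThinAlgebra K R) : f * g * h = f * (g * h) := by
  ext x w
  by_cases hxw : R x w
  · rw [mul_apply_of_rel _ _ hxw, mul_apply_of_rel _ _ hxw]
    have h1 : ∀ z, (f * g) x z * h z w = ∑ y, f x y * g y z * h z w := by
      intro z
      by_cases hxz : R x z
      · rw [mul_apply_of_rel _ _ hxz, Finset.sum_mul]
      · rw [apply_eq_zero _ hxz, zero_mul, eq_comm]
        refine Finset.sum_eq_zero fun y _ => ?_
        by_contra hne
        obtain ⟨hfg, hh⟩ := mul_ne_zero_iff.1 hne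
        obtain ⟨hf, hg⟩ := mul_ne_zero_iff.1 hfg
        exact hxz (IsThinRel.trans_left (rel_of_apply_ne_zero hf) (rel_of_apply_ne_zero hg)
          (rel_of_apply_ne_zero hh) hxw)
    have h2 : ∀ y, f x y * (g * h) y w = ∑ z, f x y * g y z * h z w := by
      intro y
      by_cases hyw : R y w
      · rw [mul_apply_of_rel _ _ hyw, Finset.mul_sum]
        simp only [mul_assoc]
      · rw [apply_eq_zero _ hyw, mul_zero, eq_comm]
        refine Finset.sum_eq_zero fun z _ => ?_
        by_contra hne
        obtain ⟨hfg, hh⟩ := mul_ne_zero_iff.1 hne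
        obtain ⟨hf, hg⟩ := mul_ne_zero_iff.1 hfg
        exact hyw (IsThinRel.trans_right (rel_of_apply_ne_zero hf) (rel_of_apply_ne_zero hg)
          (rel_of_apply_ne_zero hh) hxw)
    simp only [h1, h2]
    exact Finset.sum_comm
  · rw [apply_eq_zero _ hxw, apply_eq_zero _ hxw]

protected theorem one_mul (f : ThinAlgebra K R) : 1 * f = f := by
  ext x z
  by_cases h : R x z
  · rw [mul_apply_of_rel _ _ h, Finset.sum_eq_single x]
    · simp [one_apply, IsThinRel.refl_left h]
    · intro y _ hy; simp [one_apply, hy.symm]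
    · simp
  · rw [apply_eq_zero _ h, apply_eq_zero _ h]

protected theorem mul_one (f : ThinAlgebra K R) : f * 1 = f := by
  ext x z
  by_cases h : R x z
  · rw [mul_apply_of_rel _ _ h, Finset.sum_eq_single z]
    · simp [one_apply, IsThinRel.refl_right h]
    · intro y _ hy; simp [one_apply, hy]
    · simp
  · rw [apply_eq_zero _ h, apply_eq_zero _ h]

theorem mul_ext {f g h : ThinAlgebra K R}
    (H : ∀ x z, R x z → (∑ y, f x y * g y z) = h x z) : f * g = h := by
  ext x z
  by_cases hxz : R x z
  · rw [mul_apply_of_rel _ _ hxz, H x z hxz]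
  · rw [apply_eq_zero _ hxz, apply_eq_zero _ hxz]

noncomputable instance : Ring (ThinAlgebra K R) where
  __ := (inferInstance : AddCommGroup (ThinAlgebra K R))
  left_distrib f g h := mul_ext fun x z hxz => by
    simp [mul_apply_of_rel _ _ hxz, mul_add, Finset.sum_add_distrib]
  right_distrib f g h := mul_ext fun x z hxz => by
    simp [mul_apply_of_rel _ _ hxz, add_mul, Finset.sum_add_distrib]
  zero_mul f := mul_ext fun x z _ => by simp
  mul_zero f := mul_ext fun x z _ => by simp
  mul_assoc := ThinAlgebra.mul_assoc
  one_mul := ThinAlgebra.one_mul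
  mul_one := ThinAlgebra.mul_one

noncomputable instance : Algebra K (ThinAlgebra K R) :=
  Algebra.ofModule
    (fun c f g => mul_ext fun x z hxz => by
      simp [mul_apply_of_rel _ _ hxz, Finset.mul_sum, mul_assoc])
    (fun c f g => mul_ext fun x z hxz => by
      simp [mul_apply_of_rel _ _ hxz, Finset.mul_sum, mul_left_comm])

open Classical in
variable (K R) in
/-- The matrix unit at `(x, y)`; it is `0` if `R x y` fails. -/
noncomputable def e (x y : V) : ThinAlgebra K R :=
  mk (fun a b => if a = x ∧ b = y ∧ R x y then 1 else 0) fun a b h => if_neg (by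
    rintro ⟨rfl, rfl, h'⟩; exact h h')

open Classical in
theorem e_apply (x y a b : V) :
    e K R x y a b = if a = x ∧ b = y ∧ R x y then 1 else 0 := rfl

theorem e_eq_zero {x y : V} (h : ¬ R x y) : e K R x y = 0 := by
  ext a b; simp [e_apply, h]

open Classical in
theorem mul_e (f : ThinAlgebra K R) {y z : V} (h : R y z) :
    f * e K R y z = ∑ x, f x y • e K R x z := by
  refine mul_ext fun a b hab => ?_
  rw [Finset.sum_eq_single y]
  · rw [sum_apply, Finset.sum_eq_single a]
    · by_cases hb : b = z
      · subst hb; simp [e_apply, h, hab]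
      · simp [e_apply, hb]
    · intro x _ hx; simp [e_apply, hx.symm]
    · simp
  · intro x _ hx; simp [e_apply, hx]
  · simp

open Classical in
theorem e_mul (f : ThinAlgebra K R) {x y : V} (h : R x y) :
    e K R x y * f = ∑ z, f y z • e K R x z := by
  refine mul_ext fun a b hab => ?_
  rw [Finset.sum_eq_single y]
  · rw [sum_apply, Finset.sum_eq_single b]
    · by_cases ha : a = x
      · subst ha; simp [e_apply, h, hab]
      · simp [e_apply, ha]
    · intro x _ hx; simp [e_apply, hx.symm]
    · simp
  · intro x _ hx; simp [e_apply, hx]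
  · simp

theorem e_mul_e {x y z : V} (hxy : R x y) (hyz : R y z) :
    e K R x y * e K R y z = e K R x z := by
  rw [e_mul _ hxy, Finset.sum_eq_single z]
  · simp [e_apply, hyz]
  · intro b _ hb; simp [e_apply, hb]
  · simp

theorem e_mul_e_of_ne {x y y' z : V} (h : y ≠ y') :
    e K R x y * e K R y' z = 0 := by
  refine mul_ext fun a b _ => Finset.sum_eq_zero fun c _ => ?_
  by_cases hc : c = y
  · subst hc; simp [e_apply, h]
  · simp [e_apply, hc]

theorem e_self_mul_e (x y : V) : e K R x x * e K R x y = e K R x y := by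
  by_cases h : R x y
  · exact e_mul_e (IsThinRel.refl_left h) h
  · rw [e_eq_zero h, mul_zero]

theorem e_mul_e_self (x y : V) : e K R x y * e K R y y = e K R x y := by
  by_cases h : R x y
  · exact e_mul_e h (IsThinRel.refl_right h)
  · rw [e_eq_zero h, zero_mul]

theorem sum_e_self : ∑ x, e K R x x = 1 := by
  ext a b
  rw [sum_apply, Finset.sum_eq_single a]
  · by_cases hab : a = b
    · subst hab
      by_cases h : R a a <;> simp [e_apply, one_apply, h]
    · simp [e_apply, one_apply, hab, Ne.symm hab]
  · intro x _ hx; simp [e_apply, hx.symm]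
  · simp

/-! ### Modules over thin algebras -/

section Modules

variable {X : Type*} [AddCommGroup X] [Module (ThinAlgebra K R) X]

theorem sum_e_smul (v : X) : ∑ x, e K R x x • v = v := by
  rw [← Finset.sum_smul, sum_e_self, one_smul]

theorem exists_e_smul_ne_zero {v : X} (hv : v ≠ 0) : ∃ x, e K R x x • v ≠ 0 := by
  by_contra! h
  exact hv (by rw [← sum_e_smul (K := K) (R := R) v]; simp [h])

end Modules

end ThinAlgebra

/-- The vertex sets `S` that carry a thin module: if two vertices of `S` are connected by a
composable pair of matrix units, then their product is nonzero and passes through `S`. -/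
class IsThinSupport {V : Type} (R : V → V → Prop) (S : V → Prop) : Prop where
  refl : ∀ {x}, S x → R x x
  trans : ∀ {x y z}, S x → S z → R x y → R y z → R x z ∧ S y

/-- The functions `V → K` that vanish outside of `S`. -/
def functionsOn (K : Type u) [Field K] {V : Type} (S : V → Prop) : Submodule K (V → K) where
  carrier := {u | ∀ x, ¬ S x → u x = 0}
  add_mem' hf hg x h := by simp [hf x h, hg x h]
  zero_mem' _ _ := rfl
  smul_mem' c f hf x h := by simp [hf x h]

/-- The thin module with support `S`: it has a copy of `K` at every vertex of `S`, and all matrix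
units between vertices of `S` act as the identity of `K`. -/
def ThinModule (K : Type u) [Field K] {V : Type} (S : V → Prop) : Type u := functionsOn K S

namespace ThinModule

open ThinAlgebra

variable {K : Type u} [Field K] {V : Type} {R : V → V → Prop} {S : V → Prop}

noncomputable instance : AddCommGroup (ThinModule K S) :=
  inferInstanceAs (AddCommGroup (functionsOn K S))

noncomputable instance : Module K (ThinModule K S) :=
  inferInstanceAs (Module K (functionsOn K S))

/-- The element of a thin module with the given coefficients. -/
def mk (u : V → K) (hu : ∀ x, ¬ S x → u x = 0) : ThinModule K S := ⟨u, hu⟩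

instance : FunLike (ThinModule K S) V K where
  coe u := Subtype.val (p := (· ∈ functionsOn K S)) u
  coe_injective := Subtype.val_injective

@[simp] theorem mk_apply (u : V → K) (hu : ∀ x, ¬ S x → u x = 0) (x : V) : mk u hu x = u x := rfl

@[ext]
theorem ext {u v : ThinModule K S} (h : ∀ x, S x → u x = v x) : u = v :=
  DFunLike.ext _ _ fun x => by
    by_cases hx : S x
    · exact h x hx
    · exact (u.2 x hx).trans (v.2 x hx).symm

theorem apply_eq_zero (u : ThinModule K S) {x : V} (h : ¬ S x) : u x = 0 := u.2 x h

@[simp] theorem add_apply (u v : ThinModule K S) (x : V) : (u + v) x = u x + v x := rfl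

@[simp] theorem zero_apply (x : V) : (0 : ThinModule K S) x = 0 := rfl

@[simp] theorem smul_apply (c : K) (u : ThinModule K S) (x : V) : (c • u) x = c * u x := rfl

@[simp] theorem sum_apply {ι : Type*} (s : Finset ι) (f : ι → ThinModule K S) (x : V) :
    (∑ i ∈ s, f i) x = ∑ i ∈ s, f i x := by
  classical
  induction s using Finset.induction_on with
  | empty => simp
  | insert a s ha ih => simp [Finset.sum_insert ha, ih]

open Classical in
variable (K S) in
/-- The basis vector at `x`; it is `0` if `x` is not in `S`. -/
noncomputable def basisVec (x : V) : ThinModule K S :=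
  mk (fun y => if y = x ∧ S x then 1 else 0) fun y h => if_neg (by rintro ⟨rfl, h'⟩; exact h h')

open Classical in
theorem basisVec_apply (x y : V) : basisVec K S x y = if y = x ∧ S x then 1 else 0 := rfl

theorem basisVec_apply_self {x : V} (h : S x) : basisVec K S x x = 1 := by
  simp [basisVec_apply, h]

theorem basisVec_ne_zero {x : V} (h : S x) : basisVec K S x ≠ 0 := fun h0 => by
  have := basisVec_apply_self (K := K) h
  rw [h0] at this
  exact zero_ne_one this

variable [Fintype V]

instance : Module.Finite K (ThinModule K S) :=
  inferInstanceAs (Module.Finite K (functionsOn K S))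

open Classical in
noncomputable instance : SMul (ThinAlgebra K R) (ThinModule K S) :=
  ⟨fun f u => mk (fun x => if S x then ∑ y, f x y * u y else 0) fun _ h => if_neg h⟩

theorem smul_apply_of_mem (f : ThinAlgebra K R) (u : ThinModule K S) {x : V} (h : S x) :
    (f • u) x = ∑ y, f x y * u y := if_pos h

variable [IsThinRel R] [IsThinSupport R S]

noncomputable instance : Module (ThinAlgebra K R) (ThinModule K S) where
  one_smul u := by
    ext x hx
    rw [smul_apply_of_mem _ _ hx, Finset.sum_eq_single x]
    · have : R x x := IsThinSupport.refl hx
      simp [ThinAlgebra.one_apply, this]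
    · intro y _ hy; simp [ThinAlgebra.one_apply, hy.symm]
    · simp
  mul_smul f g u := by
    ext x hx
    rw [smul_apply_of_mem _ _ hx, smul_apply_of_mem _ _ hx]
    have h1 : ∀ z, (f * g) x z * u z = ∑ y, f x y * g y z * u z := by
      intro z
      by_cases hz : S z
      · by_cases hxz : R x z
        · rw [mul_apply_of_rel _ _ hxz, Finset.sum_mul]
        · rw [ThinAlgebra.apply_eq_zero _ hxz, zero_mul, eq_comm]
          refine Finset.sum_eq_zero fun y _ => ?_
          by_contra hne
          obtain ⟨hf, hg⟩ := mul_ne_zero_iff.1 (mul_ne_zero_iff.1 hne).1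
          exact hxz (IsThinSupport.trans hx hz (rel_of_apply_ne_zero hf)
            (rel_of_apply_ne_zero hg)).1
      · simp [apply_eq_zero u hz]
    have h2 : ∀ y, f x y * (g • u) y = ∑ z, f x y * g y z * u z := by
      intro y
      by_cases hy : S y
      · rw [smul_apply_of_mem _ _ hy, Finset.mul_sum]
        simp only [mul_assoc]
      · rw [apply_eq_zero _ hy, mul_zero, eq_comm]
        refine Finset.sum_eq_zero fun z _ => ?_
        by_contra hne
        obtain ⟨hfg, hu⟩ := mul_ne_zero_iff.1 hne
        obtain ⟨hf, hg⟩ := mul_ne_zero_iff.1 hfg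
        have hz : S z := by
          by_contra hz
          exact hu (apply_eq_zero u hz)
        exact hy (IsThinSupport.trans hx hz (rel_of_apply_ne_zero hf)
          (rel_of_apply_ne_zero hg)).2
    simp only [h1, h2]
    exact Finset.sum_comm
  smul_zero f := by ext x hx; simp [smul_apply_of_mem _ _ hx]
  zero_smul f := by ext x hx; simp [smul_apply_of_mem _ _ hx]
  smul_add f u v := by
    ext x hx; simp [smul_apply_of_mem _ _ hx, mul_add, Finset.sum_add_distrib]
  add_smul f g u := by
    ext x hx; simp [smul_apply_of_mem _ _ hx, add_mul, Finset.sum_add_distrib]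

instance : IsScalarTower K (ThinAlgebra K R) (ThinModule K S) where
  smul_assoc c f u := by
    ext x hx
    simp [smul_apply_of_mem _ _ hx, Finset.mul_sum, mul_assoc]

instance : Module.Finite (ThinAlgebra K R) (ThinModule K S) :=
  Module.Finite.of_restrictScalars_finite K _ _

open Classical in
theorem e_smul_apply (x y z : V) (u : ThinModule K S) :
    (e K R x y • u) z = if z = x ∧ R x y ∧ S x then u y else 0 := by
  by_cases hz : S z
  · rw [smul_apply_of_mem _ _ hz, Finset.sum_eq_single y]
    · by_cases h : z = x
      · subst h; simp [e_apply, hz]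
      · simp [e_apply, h]
    · intro w _ hw; simp [e_apply, hw]
    · simp
  · rw [apply_eq_zero _ hz, eq_comm]
    exact if_neg (by rintro ⟨rfl, -, h⟩; exact hz h)

theorem e_smul_apply_self {x y : V} (h : R x y) (hx : S x) (u : ThinModule K S) :
    (e K R x y • u) x = u y := by
  simp [e_smul_apply, h, hx]

theorem e_smul_of_notMem {x y : V} (h : ¬ S x) (u : ThinModule K S) : e K R x y • u = 0 := by
  ext z hz
  simp [e_smul_apply, h]

theorem e_smul_basisVec {x y : V} (h : R x y) (hy : S y) :
    e K R x y • basisVec K S y = basisVec K S x := by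
  ext z hz
  by_cases hzx : z = x
  · subst hzx; simp [e_smul_apply, basisVec_apply, hy, h, hz]
  · simp [e_smul_apply, basisVec_apply, hzx]

variable (R) in
/-- The vertex `g` of `S` generates the thin module with support `S`. -/
def IsGenerator (S : V → Prop) (g : V) : Prop := S g ∧ ∀ x, S x → R x g

theorem eq_sum_e_smul {g : V} (hg : IsGenerator R S g) (u : ThinModule K S) :
    u = ∑ x, u x • e K R x g • basisVec K S g := by
  ext z hz
  rw [sum_apply, Finset.sum_eq_single z]
  · rw [e_smul_basisVec (hg.2 z hz) hg.1]
    simp [basisVec_apply, hz]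
  · intro x _ hx
    rw [smul_apply, e_smul_apply, if_neg (fun h => hx h.1.symm), mul_zero]
  · simp

section Lift

variable {X : Type*} [AddCommGroup X] [Module (ThinAlgebra K R) X] [Module K X]
  [IsScalarTower K (ThinAlgebra K R) X]

/-- An element of a module that is killed by the matrix units leading from the generator `g` out
of `S` defines a homomorphism from the thin module with support `S`. -/
noncomputable def lift {g : V} (hg : IsGenerator R S g) (v : X)
    (hv : ∀ x, ¬ S x → e K R x g • v = 0) : ThinModule K S →ₗ[ThinAlgebra K R] X where
  toFun u := ∑ x, u x • e K R x g • v
  map_add' u w := by simp [add_smul, Finset.sum_add_distrib]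
  map_smul' f u := by
    have h1 : ∀ x, (f • u) x • e K R x g • v = ∑ y, u y • f x y • e K R x g • v := by
      intro x
      by_cases hx : S x
      · rw [smul_apply_of_mem _ _ hx, Finset.sum_smul]
        refine Finset.sum_congr rfl fun y _ => ?_
        rw [smul_smul, mul_comm]
      · simp [hv x hx]
    have h2 : ∀ y, u y • f • e K R y g • v = ∑ x, u y • f x y • e K R x g • v := by
      intro y
      by_cases hy : S y
      · rw [← mul_smul f, mul_e f (hg.2 y hy), Finset.sum_smul, Finset.smul_sum]
        simp only [smul_assoc]
      · simp [apply_eq_zero u hy]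
    simp only [h1, Finset.smul_sum, RingHom.id_apply]
    simp only [smul_comm f, h2]
    exact Finset.sum_comm

theorem lift_apply {g : V} (hg : IsGenerator R S g) (v : X)
    (hv : ∀ x, ¬ S x → e K R x g • v = 0) (u : ThinModule K S) :
    lift hg v hv u = ∑ x, u x • e K R x g • v := rfl

theorem lift_basisVec {g : V} (hg : IsGenerator R S g) (v : X)
    (hv : ∀ x, ¬ S x → e K R x g • v = 0) {x : V} (hx : S x) :
    lift hg v hv (basisVec K S x) = e K R x g • v := by
  rw [lift_apply, Finset.sum_eq_single x]
  · simp [basisVec_apply, hx]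
  · intro y _ hy; simp [basisVec_apply, hy]
  · simp

open Classical in
/-- A linear functional `l` on a module defines a homomorphism to the thin module with support
`S`, where `s` generates the socle of the thin module, as soon as it vanishes on everything that
matrix units carry to `s` from outside of `S`. -/
noncomputable def colift {s : V} (hs : ∀ x, S x → R s x) (l : X →ₗ[K] K)
    (hl : ∀ x, ¬ S x → ∀ v, l (e K R s x • v) = 0) :
    X →ₗ[ThinAlgebra K R] ThinModule K S where
  toFun v := mk (fun x => if S x then l (e K R s x • v) else 0) fun _ h => if_neg h
  map_add' v w := by
    ext x hx
    simp [hx]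
  map_smul' f v := by
    ext x hx
    rw [RingHom.id_apply, smul_apply_of_mem _ _ hx]
    rw [mk_apply, if_pos hx, ← mul_smul, e_mul f (hs x hx), Finset.sum_smul, map_sum]
    refine Finset.sum_congr rfl fun y _ => ?_
    rw [smul_assoc, map_smul, smul_eq_mul]
    by_cases hy : S y
    · rw [mk_apply, if_pos hy]
    · rw [mk_apply, if_neg hy, hl y hy]

theorem colift_apply {s : V} (hs : ∀ x, S x → R s x) (l : X →ₗ[K] K)
    (hl : ∀ x, ¬ S x → ∀ v, l (e K R s x • v) = 0) (v : X) {x : V} (hx : S x) :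
    colift hs l hl v x = l (e K R s x • v) := if_pos hx

theorem hom_apply {g : V} (hg : IsGenerator R S g) (F : ThinModule K S →ₗ[ThinAlgebra K R] X)
    (u : ThinModule K S) : F u = ∑ x, u x • e K R x g • F (basisVec K S g) := by
  conv_lhs => rw [eq_sum_e_smul hg u]
  rw [map_sum]
  refine Finset.sum_congr rfl fun x _ => ?_
  rw [← map_smul, LinearMap.map_smul_of_tower]

/-- If a module has a homomorphism from and a homomorphism to the thin module with support `S`
given by an element `v` and a functional `l`, then the composite is multiplication by the value of
`l` at the image of `v` in the socle of the thin module. -/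
theorem colift_lift {g : V} (hg : IsGenerator R S g) (v : X)
    (hv : ∀ x, ¬ S x → e K R x g • v = 0) {s : V} (hs : ∀ x, S x → R s x) (l : X →ₗ[K] K)
    (hl : ∀ x, ¬ S x → ∀ v, l (e K R s x • v) = 0) (u : ThinModule K S) :
    colift hs l hl (lift hg v hv u) = l (e K R s g • v) • u := by
  ext x hx
  rw [colift_apply _ _ _ _ hx, lift_apply, Finset.smul_sum, map_sum, Finset.sum_eq_single x]
  · rw [smul_comm, ← mul_smul, e_mul_e (hs x hx) (hg.2 x hx), map_smul, smul_apply, mul_comm,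
      smul_eq_mul]
  · intro y _ hy
    rw [smul_comm, ← mul_smul, e_mul_e_of_ne hy.symm, zero_smul, smul_zero, map_zero]
  · simp

end Lift

variable {S' : V → Prop} [IsThinSupport R S']

open Classical in
/-- Homomorphisms between thin modules are multiples of the restriction map. -/
theorem hom_thin_apply {g : V} (hg : IsGenerator R S g)
    (F : ThinModule K S →ₗ[ThinAlgebra K R] ThinModule K S') (u : ThinModule K S) (z : V) :
    F u z = if S' z then F (basisVec K S g) g * u z else 0 := by
  rw [hom_apply hg F u, sum_apply, Finset.sum_eq_single z]
  · by_cases hz : S' z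
    · by_cases hz' : S z
      · simp [e_smul_apply, hz, hg.2 z hz', mul_comm]
      · simp [apply_eq_zero u hz']
    · simp [e_smul_apply, hz]
  · intro x _ hx
    simp [e_smul_apply, hx.symm]
  · simp

theorem hom_eq_zero_of_apply {g : V} (hg : IsGenerator R S g)
    {F : ThinModule K S →ₗ[ThinAlgebra K R] ThinModule K S'}
    (h : F (basisVec K S g) g = 0) : F = 0 := by
  ext u z hz
  rw [hom_thin_apply hg F u z, h]
  simp

/-- A nonzero homomorphism between thin modules hits the generator of its source. -/
theorem mem_of_hom_ne_zero {g : V} (hg : IsGenerator R S g)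
    {F : ThinModule K S →ₗ[ThinAlgebra K R] ThinModule K S'} (h : F ≠ 0) : S' g := by
  by_contra hg'
  exact h (hom_eq_zero_of_apply hg (apply_eq_zero _ hg'))

/-- If there is a nonzero homomorphism between thin modules, then everything below the generator
that lies in the support of the target also lies in the support of the source. -/
theorem mem_of_rel_of_hom_ne_zero {g : V} (hg : IsGenerator R S g)
    {F : ThinModule K S →ₗ[ThinAlgebra K R] ThinModule K S'} (h : F ≠ 0) {z : V}
    (hz : S' z) (hzg : R z g) : S z := by
  by_contra hz'
  refine h (hom_eq_zero_of_apply hg ?_)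
  have h0 : e K R z g • basisVec K S g = 0 := e_smul_of_notMem hz' _
  have h1 := congrArg F h0
  rw [map_smul, map_zero] at h1
  rw [← e_smul_apply_self hzg hz, h1, zero_apply]

/-- Thin modules with a generator are bricks. -/
theorem end_eq_smul {g : V} (hg : IsGenerator R S g)
    (F : ThinModule K S →ₗ[ThinAlgebra K R] ThinModule K S) (u : ThinModule K S) :
    F u = F (basisVec K S g) g • u := by
  ext z hz
  rw [hom_thin_apply hg F u z, if_pos hz, smul_apply]

variable (R) in
/-- The support of a thin module is an isomorphism invariant. -/
theorem mem_of_linearEquiv (E : ThinModule K S ≃ₗ[ThinAlgebra K R] ThinModule K S') {x : V}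
    (hx : S x) : S' x := by
  by_contra hx'
  have h0 : e K R x x • basisVec K S x = basisVec K S x :=
    e_smul_basisVec (IsThinSupport.refl hx) hx
  have h1 := congrArg E h0
  rw [map_smul, e_smul_of_notMem hx', eq_comm, E.map_eq_zero_iff] at h1
  exact basisVec_ne_zero hx h1

end ThinModule

/-! ### Indecomposable modules -/

section Indecomposable

variable {A : Type u} [Ring A]

/-- A nonzero module without nontrivial idempotent endomorphisms is indecomposable. -/
theorem indecomposable_of_idempotent (X : Type u) [AddCommGroup X] [Module A X] [Nontrivial X]
    (h : ∀ f : X →ₗ[A] X, f ∘ₗ f = f → f = 0 ∨ f = LinearMap.id) :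
    Indecomposable (ModuleCat.of A X) := by
  refine ⟨fun hz => ?_, fun Y Z i => ?_⟩
  · rw [ModuleCat.isZero_of_iff_subsingleton] at hz
    exact not_subsingleton X hz
  · have key : (i.hom ≫ Limits.biprod.fst ≫ Limits.biprod.inl ≫ i.inv) ≫
        (i.hom ≫ Limits.biprod.fst ≫ Limits.biprod.inl ≫ i.inv) =
        (i.hom ≫ Limits.biprod.fst ≫ Limits.biprod.inl ≫ i.inv) := by simp
    rcases h (i.hom ≫ Limits.biprod.fst ≫ Limits.biprod.inl ≫ i.inv).hom
      (congrArg ModuleCat.Hom.hom key) with h0 | h1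
    · left
      have h0' : (i.hom ≫ Limits.biprod.fst ≫ Limits.biprod.inl ≫ i.inv) = 0 :=
        ModuleCat.hom_ext h0
      rw [Limits.IsZero.iff_id_eq_zero]
      calc 𝟙 Y = Limits.biprod.inl ≫ i.inv ≫
            (i.hom ≫ Limits.biprod.fst ≫ Limits.biprod.inl ≫ i.inv) ≫ i.hom ≫
            Limits.biprod.fst := by simp
        _ = 0 := by rw [h0']; simp
    · right
      have h1' : (i.hom ≫ Limits.biprod.fst ≫ Limits.biprod.inl ≫ i.inv) = 𝟙 _ :=
        ModuleCat.hom_ext h1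
      rw [Limits.IsZero.iff_id_eq_zero]
      calc 𝟙 Z = Limits.biprod.inr ≫ i.inv ≫ 𝟙 _ ≫ i.hom ≫ Limits.biprod.snd := by simp
        _ = 0 := by rw [← h1']; simp

/-- A nonzero direct summand of an indecomposable module is the whole module. -/
theorem CategoryTheory.Indecomposable.nonempty_iso_of_retract {Y : ModuleCat.{u} A}
    (hY : Indecomposable Y) (T : Type u) [AddCommGroup T] [Module A T] [Nontrivial T]
    (i : T →ₗ[A] Y) (p : Y →ₗ[A] T) (hpi : p ∘ₗ i = LinearMap.id) : Nonempty (Y ≅ ModuleCat.of A T) := by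
  have hpi' : ∀ t, p (i t) = t := fun t => congrArg (fun f => f t) hpi
  let E : Y ≃ₗ[A] T × LinearMap.ker p :=
    { toFun := fun y => (p y, ⟨y - i (p y), by simp [hpi']⟩)
      map_add' := fun x y => by
        ext
        · simp
        · simp only [map_add, Prod.mk_add_mk, AddMemClass.mk_add_mk]; abel
      map_smul' := fun a y => by
        ext
        · simp
        · simp [smul_sub]
      invFun := fun z => i z.1 + z.2
      left_inv := fun y => by simp
      right_inv := fun z => by
        ext
        · simp [hpi']
        · simp [hpi'] }
  rcases hY.2 (ModuleCat.of A T) (ModuleCat.of A (LinearMap.ker p))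
    (E.toModuleIso ≪≫ (ModuleCat.biprodIsoProd (ModuleCat.of A T)
      (ModuleCat.of A (LinearMap.ker p))).symm) with h | h
  · rw [ModuleCat.isZero_of_iff_subsingleton] at h
    exact absurd h (not_subsingleton T)
  · rw [ModuleCat.isZero_of_iff_subsingleton] at h
    have hinj : Function.Injective p := by
      rw [← LinearMap.ker_eq_bot]
      exact (Submodule.subsingleton_iff_eq_bot).1 h
    exact ⟨(LinearEquiv.ofBijective p ⟨hinj, fun t => ⟨i t, hpi' t⟩⟩).toModuleIso⟩

end Indecomposable

/-! ### Vanishing of first extension groups -/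

section Ext

variable {A : Type u} [Ring A]

/-- If `Ext¹(M, X)` vanishes, then maps to `X` extend along submodules with quotient `M`. -/
theorem ExtOneVanishes.exists_extension {L P M : Type u} [AddCommGroup L] [Module A L]
    [AddCommGroup P] [Module A P] [AddCommGroup M] [Module A M] {f : L →ₗ[A] P} {g : P →ₗ[A] M}
    (hf : Function.Injective f) (hfg : Function.Exact f g) (hg : Function.Surjective g)
    {X : ModuleCat.{u} A} (hX : ExtOneVanishes (ModuleCat.of A M) X) (h : L →ₗ[A] X) :
    ∃ k : P →ₗ[A] X, k ∘ₗ f = h := by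
  have hS := ModuleCat.shortComplex_shortExact
    (ShortComplex.mk (ModuleCat.ofHom f) (ModuleCat.ofHom g)
      (ModuleCat.hom_ext hfg.linearMap_comp_eq_zero)) hfg hf hg
  have : Subsingleton (Abelian.Ext (ModuleCat.of A M) X 1) := hX
  obtain ⟨x, hx⟩ := Abelian.Ext.contravariant_sequence_exact₁ hS X
    (Abelian.Ext.mk₀ (ModuleCat.ofHom h)) (n₁ := 1) rfl (Subsingleton.elim _ _)
  obtain ⟨k, rfl⟩ := (Abelian.Ext.mk₀_bijective _ _).2 x
  rw [Abelian.Ext.mk₀_comp_mk₀] at hx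
  exact ⟨k.hom, congrArg ModuleCat.Hom.hom ((Abelian.Ext.mk₀_bijective _ _).1 hx)⟩

/-- The converse of `ExtOneVanishes.exists_extension` for one presentation of `M` as a quotient of a
projective module. -/
theorem extOneVanishes_of_projective {L P M : Type u} [AddCommGroup L] [Module A L]
    [AddCommGroup P] [Module A P] [AddCommGroup M] [Module A M] [Module.Projective A P]
    {f : L →ₗ[A] P} {g : P →ₗ[A] M}
    (hf : Function.Injective f) (hfg : Function.Exact f g) (hg : Function.Surjective g)
    {X : ModuleCat.{u} A} (H : ∀ h : L →ₗ[A] X, ∃ k : P →ₗ[A] X, k ∘ₗ f = h) :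
    ExtOneVanishes (ModuleCat.of A M) X := by
  have hS := ModuleCat.shortComplex_shortExact
    (ShortComplex.mk (ModuleCat.ofHom f) (ModuleCat.ofHom g)
      (ModuleCat.hom_ext hfg.linearMap_comp_eq_zero)) hfg hf hg
  have : Projective (ModuleCat.of A P) := (IsProjective.iff_projective P).1 inferInstance
  refine subsingleton_of_forall_eq 0 fun x => ?_
  obtain ⟨y, rfl⟩ := Abelian.Ext.contravariant_sequence_exact₃ hS X x
    (Abelian.Ext.eq_zero_of_projective _) (n₀ := 0) rfl
  obtain ⟨h, rfl⟩ := (Abelian.Ext.mk₀_bijective _ _).2 y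
  obtain ⟨k, hk⟩ := H h.hom
  have : h = ModuleCat.ofHom f ≫ ModuleCat.ofHom k := ModuleCat.hom_ext hk.symm
  rw [this, ← Abelian.Ext.mk₀_comp_mk₀, ← Abelian.Ext.comp_assoc_of_second_deg_zero]
  have h0 := hS.extClass_comp
  erw [h0]
  simp

/-- If `Ext¹(X, Y)` vanishes, then every short exact sequence from `Y` to `X` splits. -/
theorem ExtOneVanishes.exists_section {X Y : ModuleCat.{u} A} (h : ExtOneVanishes X Y)
    {P : Type u} [AddCommGroup P] [Module A P] {f : Y →ₗ[A] P} {g : P →ₗ[A] X}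
    (hf : Function.Injective f) (hfg : Function.Exact f g) (hg : Function.Surjective g) :
    ∃ s : X →ₗ[A] P, g ∘ₗ s = LinearMap.id := by
  have hS := ModuleCat.shortComplex_shortExact
    (ShortComplex.mk (ModuleCat.ofHom f) (ModuleCat.ofHom g)
      (ModuleCat.hom_ext hfg.linearMap_comp_eq_zero)) hfg hf hg
  have : Subsingleton (Abelian.Ext X Y 1) := h
  obtain ⟨x, hx⟩ := Abelian.Ext.covariant_sequence_exact₃ X hS
    (Abelian.Ext.mk₀ (𝟙 X)) (n₁ := 1) rfl (Subsingleton.elim _ _)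
  obtain ⟨k, rfl⟩ := (Abelian.Ext.mk₀_bijective _ _).2 x
  rw [Abelian.Ext.mk₀_comp_mk₀] at hx
  exact ⟨k.hom, congrArg ModuleCat.Hom.hom ((Abelian.Ext.mk₀_bijective _ _).1 hx)⟩

end Ext

/-! ### Direct summands of sums of members of a family -/

section Add

variable {A : Type u} [Ring A] {ι : Type*} (θ : ι → ModuleCat.{u} A)

/-- The endomorphisms of `X` that are sums of endomorphisms factoring through members of the
family `θ`. -/
def endosThrough (X : Type u) [AddCommGroup X] [Module A X] : AddSubmonoid (X →ₗ[A] X) :=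
  AddSubmonoid.closure {g | ∃ (c : ι) (i : X →ₗ[A] θ c) (p : θ c →ₗ[A] X), g = p ∘ₗ i}

variable {θ}

theorem comp_mem_endosThrough {X : Type u} [AddCommGroup X] [Module A X] {c : ι}
    (i : X →ₗ[A] θ c) (p : θ c →ₗ[A] X) : p ∘ₗ i ∈ endosThrough θ X :=
  AddSubmonoid.subset_closure ⟨c, i, p, rfl⟩

theorem comp_comp_mem_endosThrough {X Y : Type u} [AddCommGroup X] [Module A X] [AddCommGroup Y]
    [Module A Y] (i : X →ₗ[A] Y) (p : Y →ₗ[A] X) {g : Y →ₗ[A] Y} (hg : g ∈ endosThrough θ Y) :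
    p ∘ₗ g ∘ₗ i ∈ endosThrough θ X := by
  induction hg using AddSubmonoid.closure_induction with
  | mem g hg =>
    obtain ⟨c, j, q, rfl⟩ := hg
    exact comp_mem_endosThrough (θ := θ) (j ∘ₗ i) (p ∘ₗ q)
  | zero => simp [zero_mem]
  | add g h _ _ ihg ihh =>
    rw [LinearMap.add_comp, LinearMap.comp_add]
    exact add_mem ihg ihh

/-- For a finite family, lying in `add` of the direct sum can be read off from the members. -/
theorem inAdd_iff_id_mem_endosThrough {t : ℕ} {θ : Fin t → ModuleCat.{u} A} {X : ModuleCat.{u} A} :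
    InAdd (ModuleCat.of A (∀ i, θ i)) X ↔ LinearMap.id ∈ endosThrough θ X := by
  constructor
  · rintro ⟨k, i, p, hpi⟩
    have hM : (LinearMap.id : (∀ i, θ i) →ₗ[A] ∀ i, θ i) ∈ endosThrough θ (∀ i, θ i) := by
      have key : (LinearMap.id : (∀ i, θ i) →ₗ[A] ∀ i, θ i) =
          ∑ c, LinearMap.single A (fun i => θ i) c ∘ₗ LinearMap.proj c := by
        refine LinearMap.ext fun x => ?_
        simp [LinearMap.sum_apply, Finset.univ_sum_single]
      rw [key]
      exact sum_mem fun c _ => comp_mem_endosThrough _ _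
    have hMk : (LinearMap.id : (Fin k → ∀ i, θ i) →ₗ[A] Fin k → ∀ i, θ i) ∈
        endosThrough θ (Fin k → ∀ i, θ i) := by
      have key : (LinearMap.id : (Fin k → ∀ i, θ i) →ₗ[A] Fin k → ∀ i, θ i) =
          ∑ l, LinearMap.single A (fun _ => ∀ i, θ i) l ∘ₗ LinearMap.id ∘ₗ LinearMap.proj l := by
        refine LinearMap.ext fun x => ?_
        simp [LinearMap.sum_apply, Finset.univ_sum_single]
      rw [key]
      exact sum_mem fun l _ => comp_comp_mem_endosThrough _ _ hM
    rw [← hpi]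
    exact comp_comp_mem_endosThrough i p hMk
  · have : ∀ g ∈ endosThrough θ X, ∃ (k : ℕ) (i : X →ₗ[A] (Fin k → ∀ i, θ i))
        (p : (Fin k → ∀ i, θ i) →ₗ[A] X), p ∘ₗ i = g := by
      intro g hg
      induction hg using AddSubmonoid.closure_induction_left with
      | zero => exact ⟨0, 0, 0, by simp⟩
      | add_left g hg h _ ih =>
        obtain ⟨c, j, q, rfl⟩ := hg
        obtain ⟨k, i, p, rfl⟩ := ih
        refine ⟨k + 1, (Fin.consLinearEquiv A (fun _ => ∀ i, θ i)).toLinearMap ∘ₗ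
          ((LinearMap.single A (fun i => θ i) c ∘ₗ j).prod i),
          ((q ∘ₗ LinearMap.proj c).coprod p) ∘ₗ
          (Fin.consLinearEquiv A (fun _ => ∀ i, θ i)).symm.toLinearMap, ?_⟩
        ext x
        simp
    exact this _

/-- Extensions by `Y` vanish on `X` if they do on the members of the family and `X` is a summand of
a sum of members of the family. -/
theorem extOneVanishes_of_id_mem_endosThrough {X Y : ModuleCat.{u} A}
    (h : LinearMap.id ∈ endosThrough θ X) (H : ∀ c, ExtOneVanishes (θ c) Y) :
    ExtOneVanishes X Y := by
  have key : ∀ g ∈ endosThrough θ X, ∀ α : Abelian.Ext X Y 1,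
      (Abelian.Ext.mk₀ (ModuleCat.ofHom g)).comp α (zero_add 1) = 0 := by
    intro g hg α
    induction hg using AddSubmonoid.closure_induction with
    | mem g hg =>
      obtain ⟨c, i, p, rfl⟩ := hg
      have : Subsingleton (Abelian.Ext (θ c) Y 1) := H c
      rw [ModuleCat.ofHom_comp, ← Abelian.Ext.mk₀_comp_mk₀_assoc,
        Subsingleton.elim ((Abelian.Ext.mk₀ (ModuleCat.ofHom p)).comp α (zero_add 1)) 0,
        Abelian.Ext.comp_zero]
    | zero =>
      rw [ModuleCat.ofHom_zero, Abelian.Ext.mk₀_zero, Abelian.Ext.zero_comp]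
    | add g h _ _ ihg ihh =>
      rw [ModuleCat.ofHom_add, Abelian.Ext.mk₀_add, Abelian.Ext.add_comp, ihg, ihh, add_zero]
  refine subsingleton_of_forall_eq 0 fun α => ?_
  rw [← key _ h α]
  exact (Abelian.Ext.mk₀_id_comp α).symm

end Add

/-! ### Thin modules in the module category -/

namespace ThinModule

open ThinAlgebra

variable {K : Type u} [Field K] {V : Type} [Fintype V] {R : V → V → Prop} [IsThinRel R]
  {S : V → Prop} [IsThinSupport R S]

theorem idempotent_eq_zero_or_id {g : V} (hg : IsGenerator R S g)
    (f : ThinModule K S →ₗ[ThinAlgebra K R] ThinModule K S) (hf : f ∘ₗ f = f) :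
    f = 0 ∨ f = LinearMap.id := by
  have h1 := congrArg (fun F => F (basisVec K S g) g) hf
  simp only [LinearMap.comp_apply] at h1
  rw [end_eq_smul hg f (f _), smul_apply] at h1
  rcases IsIdempotentElem.iff_eq_zero_or_one.1 h1 with h | h
  · left
    ext1 u
    rw [end_eq_smul hg f, h, zero_smul, LinearMap.zero_apply]
  · right
    ext1 u
    rw [end_eq_smul hg f, h, one_smul, LinearMap.id_apply]

theorem indecomposable {g : V} (hg : IsGenerator R S g) :
    Indecomposable (ModuleCat.of (ThinAlgebra K R) (ThinModule K S)) := by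
  have : Nontrivial (ThinModule K S) := ⟨_, _, basisVec_ne_zero hg.1⟩
  exact indecomposable_of_idempotent _ (idempotent_eq_zero_or_id hg)

variable (R) in
/-- The support of the projective module at `x`. -/
def below (x : V) : V → Prop := fun y => R y x

instance (x : V) : IsThinSupport R (below R x) where
  refl h := IsThinRel.refl_left h
  trans ha hc hab hbc :=
    ⟨IsThinRel.trans_left (R := R) hab hbc hc ha, IsThinRel.trans_right (R := R) hab hbc hc ha⟩

theorem isGenerator_below {x : V} (hx : R x x) : IsGenerator R (below R x) x :=
  ⟨hx, fun _ h => h⟩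

theorem projective_of_forall_rel {g : V} (hg : IsGenerator R S g) (h : ∀ x, R x g → S x) :
    Module.Projective (ThinAlgebra K R) (ThinModule K S) := by
  refine Module.Projective.of_lifting_property fun {M N} _ _ _ _ f F hf => ?_
  let _ : Module K M := Module.restrictScalars K (ThinAlgebra K R) M
  have : IsScalarTower K (ThinAlgebra K R) M := IsScalarTower.restrictScalars K _ M
  let _ : Module K N := Module.restrictScalars K (ThinAlgebra K R) N
  have : IsScalarTower K (ThinAlgebra K R) N := IsScalarTower.restrictScalars K _ N
  obtain ⟨v, hv⟩ := hf (F (basisVec K S g))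
  refine ⟨lift hg v fun x hx => by rw [e_eq_zero fun hR => hx (h x hR), zero_smul], ?_⟩
  ext1 u
  rw [LinearMap.comp_apply, lift_apply, map_sum, hom_apply hg F u]
  refine Finset.sum_congr rfl fun x _ => ?_
  rw [LinearMap.map_smul_of_tower, map_smul, hv]

end ThinModule

namespace ThinAlgebra

open ThinModule

variable (K : Type u) [Field K] {V : Type} [Fintype V] (R : V → V → Prop) [IsThinRel R]

/-- The decomposition of the regular module according to the columns of a matrix. -/
noncomputable def regularEquiv {s : ℕ} (g : Fin s ≃ {x // R x x}) :
    ThinAlgebra K R ≃ₗ[ThinAlgebra K R] ∀ i, ThinModule K (below R (g i).1) := by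
  classical
  exact
  { toFun := fun f i => ThinModule.mk (fun y => f y (g i).1) fun _ h => f.apply_eq_zero h
    map_add' := fun f h => by ext i x hx; simp
    map_smul' := fun f h => by
      ext i x hx
      have hx' : R x (g i).1 := hx
      simp [smul_apply_of_mem _ _ hx, mul_apply_of_rel _ _ hx']
    invFun := fun p => ThinAlgebra.mk
      (fun y x => if h : R x x then p (g.symm ⟨x, h⟩) y else 0) fun y x h => by
        by_cases hx : R x x
        · rw [dif_pos hx]
          refine ThinModule.apply_eq_zero _ fun hb => h ?_
          simpa [below] using hb
        · rw [dif_neg hx]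
    left_inv := fun f => by
      ext y x
      by_cases hx : R x x
      · simp [hx]
      · simp only [ThinAlgebra.mk_apply, dif_neg hx]
        exact (f.apply_eq_zero fun h => hx (IsThinRel.refl_right h)).symm
    right_inv := fun p => by
      ext i x hx
      simp only [ThinModule.mk_apply, ThinAlgebra.mk_apply, dif_pos (g i).2]
      rw [Equiv.symm_apply_apply] }

theorem isBasicAlgebra : IsBasicAlgebra (ThinAlgebra K R) := by
  classical
  let g : Fin (Fintype.card {x // R x x}) ≃ {x // R x x} := (Fintype.equivFin _).symm
  refine ⟨_, fun i => ModuleCat.of _ (ThinModule K (below R (g i).1)),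
    fun i => ThinModule.indecomposable (isGenerator_below (g i).2), fun i j ⟨E⟩ => ?_,
    ⟨regularEquiv K R g⟩⟩
  refine g.injective (Subtype.ext (IsThinRel.antisymm (R := R) ?_ ?_))
  · exact mem_of_linearEquiv R (S' := below R (g j).1) E.toLinearEquiv
      (x := (g i).1) (isGenerator_below (g i).2).1
  · exact mem_of_linearEquiv R (S' := below R (g i).1) E.symm.toLinearEquiv
      (x := (g j).1) (isGenerator_below (g j).2).1

end ThinAlgebra

/-! ### The Grothendieck group of a thin algebra -/

namespace ThinAlgebra

open ThinModule

variable {K : Type u} [Field K] {V : Type} [Fintype V] (R : V → V → Prop) [IsThinRel R]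

/-- The support of the simple module at `x`. -/
def only (x : V) : V → Prop := fun y => y = x ∧ R x x

instance (x : V) : IsThinSupport R (only R x) where
  refl h := h.1 ▸ h.2
  trans {a b c} ha hc hab hbc := by
    obtain ⟨rfl, hx⟩ := ha
    obtain ⟨rfl, -⟩ := hc
    exact ⟨hx, (IsThinRel.antisymm hab hbc).symm, hx⟩

theorem isGenerator_only {x : V} (hx : R x x) : IsGenerator R (only R x) x :=
  ⟨⟨rfl, hx⟩, fun _ hy => hy.1 ▸ hx⟩

section

variable (K) (X : Type*) [AddCommGroup X] [Module (ThinAlgebra K R) X] [Module K X]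
  [IsScalarTower K (ThinAlgebra K R) X]

/-- The component of a module at the vertex `x`. -/
def component (x : V) : Submodule K X where
  carrier := {v | e K R x x • v = v}
  add_mem' {v w} hv hw := by
    rw [Set.mem_ofPred_eq] at hv hw ⊢
    rw [smul_add, hv, hw]
  zero_mem' := smul_zero _
  smul_mem' c v hv := by
    rw [Set.mem_ofPred_eq] at hv ⊢
    rw [smul_comm, hv]

variable {K X}

theorem mem_component {x : V} {v : X} : v ∈ component K R X x ↔ e K R x x • v = v := Iff.rfl

theorem e_smul_mem_component (x y : V) (v : X) : e K R x y • v ∈ component K R X x := by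
  rw [mem_component, ← mul_smul, e_self_mul_e]

end

section Additivity

variable {X Y Z : Type*} [AddCommGroup X] [Module (ThinAlgebra K R) X] [Module K X]
  [IsScalarTower K (ThinAlgebra K R) X] [AddCommGroup Y] [Module (ThinAlgebra K R) Y] [Module K Y]
  [IsScalarTower K (ThinAlgebra K R) Y] [AddCommGroup Z] [Module (ThinAlgebra K R) Z] [Module K Z]
  [IsScalarTower K (ThinAlgebra K R) Z]

/-- The effect of a homomorphism on the components at `x`. -/
noncomputable def componentMap (f : X →ₗ[ThinAlgebra K R] Y) (x : V) :
    component K R X x →ₗ[K] component K R Y x :=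
  (f.restrictScalars K).restrict fun v hv => by
    rw [mem_component] at hv ⊢
    rw [LinearMap.restrictScalars_apply, ← map_smul, hv]

theorem componentMap_apply (f : X →ₗ[ThinAlgebra K R] Y) (x : V) (v : component K R X x) :
    (componentMap R f x v : Y) = f v := rfl

/-- Dimension vectors are additive on short exact sequences. -/
theorem finrank_component [Module.Finite K Y] {f : X →ₗ[ThinAlgebra K R] Y}
    {g : Y →ₗ[ThinAlgebra K R] Z} (hf : Function.Injective f) (hfg : Function.Exact f g)
    (hg : Function.Surjective g) (x : V) :
    Module.finrank K (component K R Y x) =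
      Module.finrank K (component K R X x) + Module.finrank K (component K R Z x) := by
  have hsurj : Function.Surjective (componentMap R g x) := fun z => by
    obtain ⟨y, hy⟩ := hg z
    refine ⟨⟨e K R x x • y, e_smul_mem_component R x x y⟩, Subtype.ext ?_⟩
    rw [componentMap_apply, map_smul, hy]
    exact z.2
  have hinj : Function.Injective (componentMap R f x) := fun v w h =>
    Subtype.ext (hf (congrArg Subtype.val h))
  have hker : LinearMap.ker (componentMap R g x) = LinearMap.range (componentMap R f x) := by
    ext y
    rw [LinearMap.mem_ker, LinearMap.mem_range]
    constructor
    · intro h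
      obtain ⟨v, hv⟩ := (hfg y).1 (congrArg Subtype.val h)
      refine ⟨⟨v, hf ?_⟩, Subtype.ext hv⟩
      rw [map_smul, hv]
      exact y.2
    · rintro ⟨v, rfl⟩
      exact Subtype.ext ((hfg _).2 ⟨v, rfl⟩)
  rw [← LinearMap.finrank_range_add_finrank_ker (componentMap R g x), hker,
    LinearMap.finrank_range_of_inj hinj, LinearMap.range_eq_top.2 hsurj, finrank_top, add_comm]

end Additivity

open Classical in
theorem finrank_component_simple (x y : V) (hx : R x x) :
    Module.finrank K (component K R (ThinModule K (only R x)) y) = if y = x then 1 else 0 := by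
  by_cases h : y = x
  · subst h
    rw [if_pos rfl]
    have hS : only R y y := ⟨rfl, hx⟩
    refine finrank_eq_one ⟨basisVec K _ y, ?_⟩ ?_ ?_
    · exact e_smul_basisVec hx hS
    · exact fun h => basisVec_ne_zero (K := K) hS (congrArg Subtype.val h)
    · intro w
      refine ⟨w.1 y, Subtype.ext ?_⟩
      ext z hz
      obtain ⟨rfl, -⟩ := hz
      change w.1 z * basisVec K (only R z) z z = w.1 z
      rw [basisVec_apply_self hS, mul_one]
  · rw [if_neg h]
    have : Subsingleton (component K R (ThinModule K (only R x)) y) := by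
      refine subsingleton_of_forall_eq 0 fun w => Subtype.ext ?_
      have hw := (mem_component R).1 w.2
      rw [← hw, e_smul_of_notMem fun h' => h h'.1]
      rfl
    exact Module.finrank_zero_of_subsingleton

/-- Every nonzero module over a thin algebra without oriented cycles has a simple submodule that is
a thin module supported at a single vertex. -/
theorem exists_simple_injective {rk : V → ℕ} (hrk : ∀ x y, R x y → x ≠ y → rk x < rk y)
    (X : Type*) [AddCommGroup X] [Module (ThinAlgebra K R) X] [Module K X]
    [IsScalarTower K (ThinAlgebra K R) X] [Nontrivial X] :
    ∃ x, R x x ∧ ∃ f : ThinModule K (only R x) →ₗ[ThinAlgebra K R] X, Function.Injective f := by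
  classical
  have hne : ∃ k x, rk x = k ∧ ∃ v : X, e K R x x • v ≠ 0 := by
    obtain ⟨v, hv⟩ := exists_ne (0 : X)
    obtain ⟨x, hx⟩ := exists_e_smul_ne_zero (K := K) (R := R) hv
    exact ⟨_, x, rfl, v, hx⟩
  obtain ⟨x, hxk, v, hv⟩ := Nat.find_spec hne
  have hmin : ∀ y, rk y < rk x → ∀ w : X, e K R y y • w = 0 := by
    intro y hy w
    by_contra hw
    exact Nat.find_min hne (hxk ▸ hy) ⟨y, rfl, w, hw⟩
  have hx : R x x := by
    by_contra hx
    exact hv (by rw [e_eq_zero hx, zero_smul])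
  refine ⟨x, hx, ThinModule.lift (isGenerator_only R hx) v fun y hy => ?_, ?_⟩
  · by_cases hyx : R y x
    · have : y ≠ x := fun h => hy ⟨h, hx⟩
      rw [← e_self_mul_e, mul_smul, hmin y (hrk y x hyx this)]
    · rw [e_eq_zero hyx, zero_smul]
  · rw [injective_iff_map_eq_zero]
    intro u hu
    rw [lift_apply, Finset.sum_eq_single x] at hu
    · ext y hy
      rw [hy.1]
      exact (smul_eq_zero.1 hu).resolve_right hv
    · intro y _ hy
      rw [ThinModule.apply_eq_zero u fun h => hy h.1, zero_smul]
    · simp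

section K0

/-- The class of a finitely generated module in the Grothendieck group. -/
def k0Class {A : Type u} [Ring A] (X : Type u) [AddCommGroup X] [Module A X] [Module.Finite A X] :
    GrothendieckK0 A :=
  QuotientAddGroup.mk (FreeAbelianGroup.of ⟨ModuleCat.of A X, ‹_›⟩)

/-- The defining relation of the Grothendieck group. -/
theorem k0Class_eq_add {A : Type u} [Ring A] {X Y Z : Type u} [AddCommGroup X] [Module A X]
    [Module.Finite A X] [AddCommGroup Y] [Module A Y] [Module.Finite A Y] [AddCommGroup Z]
    [Module A Z] [Module.Finite A Z] {f : X →ₗ[A] Y} {g : Y →ₗ[A] Z} (hf : Function.Injective f)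
    (hfg : Function.Exact f g) (hg : Function.Surjective g) :
    k0Class (A := A) Y = k0Class (A := A) X + k0Class (A := A) Z := by
  rw [← sub_eq_zero, ← sub_sub]
  refine (QuotientAddGroup.eq_zero_iff _).2 (AddSubgroup.subset_closure ?_)
  exact ⟨⟨ModuleCat.of A X, ‹_›⟩, ⟨ModuleCat.of A Y, ‹_›⟩, ⟨ModuleCat.of A Z, ‹_›⟩, f, g, hf, hfg,
    hg, rfl⟩

open Classical in
/-- In the Grothendieck group, a module is the sum of its composition factors, which are counted
by its dimension vector. -/
theorem k0Class_eq_sum {rk : V → ℕ} (hrk : ∀ x y, R x y → x ≠ y → rk x < rk y) :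
    ∀ (n : ℕ) (X : Type u) [AddCommGroup X] [Module (ThinAlgebra K R) X] [Module K X]
      [IsScalarTower K (ThinAlgebra K R) X] [Module.Finite K X]
      [Module.Finite (ThinAlgebra K R) X], Module.finrank K X = n →
      k0Class (A := ThinAlgebra K R) X = ∑ x : {x // R x x},
        (Module.finrank K (component K R X x.1) : ℤ) •
          k0Class (A := ThinAlgebra K R) (ThinModule K (only R x.1)) := by
  intro n
  induction n using Nat.strong_induction_on with
  | _ n ih =>
  intro X _ _ _ _ _ _ hn
  rcases subsingleton_or_nontrivial X with hX | hX
  · have h0 : k0Class (A := ThinAlgebra K R) X = 0 := by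
      have := k0Class_eq_add (A := ThinAlgebra K R) (X := X) (Y := X) (Z := X)
        (f := LinearMap.id) (g := LinearMap.id) (fun a b h => h)
        (fun y => ⟨fun _ => ⟨y, rfl⟩, fun _ => Subsingleton.elim _ _⟩) (fun a => ⟨a, rfl⟩)
      simpa using this
    rw [h0, eq_comm]
    refine Finset.sum_eq_zero fun x _ => ?_
    rw [Module.finrank_zero_of_subsingleton, Nat.cast_zero, zero_smul]
  · obtain ⟨x, hx, f, hf⟩ := exists_simple_injective (K := K) R hrk X
    have hlt : Module.finrank K (X ⧸ LinearMap.range f) < n := by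
      have h1 := Submodule.finrank_quotient_add_finrank
        ((LinearMap.range f).restrictScalars K)
      have h2 : 0 < Module.finrank K ((LinearMap.range f).restrictScalars K) := by
        refine Module.finrank_pos_iff_exists_ne_zero.2
          ⟨⟨f (basisVec K _ x), ⟨_, rfl⟩⟩, fun h => ?_⟩
        have h3 := congrArg Subtype.val h
        exact basisVec_ne_zero (K := K) (S := only R x) ⟨rfl, hx⟩
          (hf (h3.trans (map_zero f).symm))
      have h4 : Module.finrank K (X ⧸ LinearMap.range f) =
        Module.finrank K (X ⧸ (LinearMap.range f).restrictScalars K) := rfl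
      omega
    have hex : Function.Exact f (LinearMap.range f).mkQ := LinearMap.exact_map_mkQ_range f
    have hsu : Function.Surjective (LinearMap.range f).mkQ := Submodule.mkQ_surjective _
    rw [k0Class_eq_add hf hex hsu, ih _ hlt _ rfl]
    simp only [finrank_component R hf hex hsu, Nat.cast_add, add_smul, Finset.sum_add_distrib]
    congr 1
    rw [Finset.sum_eq_single ⟨x, hx⟩]
    · rw [finrank_component_simple R x x hx, if_pos rfl, Nat.cast_one, one_smul]
    · intro y _ hy
      rw [finrank_component_simple R x y.1 hx, if_neg fun h => hy (Subtype.ext h), Nat.cast_zero,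
        zero_smul]
    · simp

variable (K) in
/-- The dimension vector, as an additive map on the Grothendieck group. -/
noncomputable def dimVector : GrothendieckK0 (ThinAlgebra K R) →+ ({x // R x x} → ℤ) :=
  QuotientAddGroup.lift (shortExactRelations (ThinAlgebra K R))
    (FreeAbelianGroup.lift fun X x =>
      letI : Module K X.1 := Module.restrictScalars K (ThinAlgebra K R) X.1
      haveI : IsScalarTower K (ThinAlgebra K R) X.1 := IsScalarTower.restrictScalars K _ _
      (Module.finrank K (component K R X.1 x.1) : ℤ))
    (by
      refine (AddSubgroup.closure_le _).2 ?_
      rintro _ ⟨X, Y, Z, f, g, hf, hfg, hg, rfl⟩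
      let _ : Module K X.1 := Module.restrictScalars K (ThinAlgebra K R) X.1
      have : IsScalarTower K (ThinAlgebra K R) X.1 := IsScalarTower.restrictScalars K _ _
      let _ : Module K Y.1 := Module.restrictScalars K (ThinAlgebra K R) Y.1
      have : IsScalarTower K (ThinAlgebra K R) Y.1 := IsScalarTower.restrictScalars K _ _
      let _ : Module K Z.1 := Module.restrictScalars K (ThinAlgebra K R) Z.1
      have : IsScalarTower K (ThinAlgebra K R) Z.1 := IsScalarTower.restrictScalars K _ _
      have : Module.Finite (ThinAlgebra K R) Y.1 := Y.2
      have : Module.Finite K Y.1 := Module.Finite.trans (ThinAlgebra K R) Y.1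
      rw [SetLike.mem_coe, AddMonoidHom.mem_ker]
      ext x
      simp only [map_sub, FreeAbelianGroup.lift_apply_of, Pi.sub_apply, Pi.zero_apply]
      rw [finrank_component R hf hfg hg x.1, Nat.cast_add]
      ring)

theorem dimVector_k0Class (X : Type u) [AddCommGroup X] [Module (ThinAlgebra K R) X]
    [inst : Module K X] [IsScalarTower K (ThinAlgebra K R) X] [Module.Finite (ThinAlgebra K R) X]
    (x : {x // R x x}) :
    dimVector K R (k0Class X) x = Module.finrank K (component K R X x.1) := by
  have h : Module.restrictScalars K (ThinAlgebra K R) X = inst := by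
    ext c v
    exact algebraMap_smul (ThinAlgebra K R) c v
  subst h
  exact congrFun (FreeAbelianGroup.lift_apply_of _ _) x

variable (K) in
/-- The Grothendieck group of a thin algebra without oriented cycles is free on the vertices. -/
noncomputable def k0Equiv {rk : V → ℕ} (hrk : ∀ x y, R x y → x ≠ y → rk x < rk y) :
    GrothendieckK0 (ThinAlgebra K R) ≃+ ({x // R x x} → ℤ) := by
  classical
  exact
  { dimVector K R with
    invFun := fun c => ∑ x, c x • k0Class (A := ThinAlgebra K R) (ThinModule K (only R x.1))
    left_inv := fun a => by
      change ∑ x, dimVector K R a x • _ = a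
      induction a using QuotientAddGroup.induction_on with | H a =>
      induction a using FreeAbelianGroup.induction_on with
      | zero => simp
      | of X =>
        let _ : Module K X.1 := Module.restrictScalars K (ThinAlgebra K R) X.1
        have : IsScalarTower K (ThinAlgebra K R) X.1 := IsScalarTower.restrictScalars K _ _
        have : Module.Finite (ThinAlgebra K R) X.1 := X.2
        have : Module.Finite K X.1 := Module.Finite.trans (ThinAlgebra K R) X.1
        have h := k0Class_eq_sum (K := K) R hrk _ X.1 rfl
        simp only [← dimVector_k0Class] at h
        exact h.symm
      | neg X h => simpa using h
      | add a b ha hb =>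
        simp only [QuotientAddGroup.mk_add, map_add, Pi.add_apply, add_smul,
          Finset.sum_add_distrib, ha, hb]
    right_inv := fun c => by
      change dimVector K R (∑ x, c x • _) = c
      ext y
      rw [map_sum, Finset.sum_apply, Finset.sum_eq_single y]
      · rw [map_zsmul, Pi.smul_apply, dimVector_k0Class, finrank_component_simple R _ _ y.2]
        simp
      · intro x _ hx
        rw [map_zsmul, Pi.smul_apply, dimVector_k0Class, finrank_component_simple R _ _ x.2,
          if_neg fun h => hx (Subtype.ext h.symm)]
        simp
      · simp }

end K0

end ThinAlgebra

/-! ### Restriction maps between thin modules -/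

namespace ThinModule

open ThinAlgebra

variable {K : Type u} [Field K] {V : Type} [Fintype V] {R : V → V → Prop} [IsThinRel R]
  {S S' : V → Prop} [IsThinSupport R S] [IsThinSupport R S']

theorem hom_ext {X : Type*} [AddCommGroup X] [Module (ThinAlgebra K R) X] {g : V}
    (hg : IsGenerator R S g) {F G : ThinModule K S →ₗ[ThinAlgebra K R] X}
    (h : F (basisVec K S g) = G (basisVec K S g)) : F = G := by
  let _ : Module K X := Module.restrictScalars K (ThinAlgebra K R) X
  have : IsScalarTower K (ThinAlgebra K R) X := IsScalarTower.restrictScalars K _ X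
  ext1 u
  rw [hom_apply hg F, hom_apply hg G, h]

open Classical in
variable (K) in
/-- The map between thin modules that is the identity at all vertices that lie in both supports and
zero elsewhere. For it to be a homomorphism, a matrix unit that leads from `y` in `S` to `x` in
`S'` must have both ends in the common part of the supports or none. -/
noncomputable def restrict (H : ∀ x y, S' x → S y → R x y → (S x ↔ S' y)) :
    ThinModule K S →ₗ[ThinAlgebra K R] ThinModule K S' where
  toFun u := mk (fun x => if S' x then u x else 0) fun _ h => if_neg h
  map_add' u v := by ext x hx; simp [hx]
  map_smul' f u := by
    ext x hx
    rw [RingHom.id_apply, smul_apply_of_mem _ _ hx, mk_apply, if_pos hx]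
    by_cases hx' : S x
    · rw [smul_apply_of_mem _ _ hx']
      refine Finset.sum_congr rfl fun y _ => ?_
      by_cases hy : S y
      · by_cases hR : R x y
        · rw [mk_apply, if_pos ((H x y hx hy hR).1 hx')]
        · rw [ThinAlgebra.apply_eq_zero _ hR, zero_mul, zero_mul]
      · rw [mk_apply, ThinModule.apply_eq_zero u hy, ite_self]
    · rw [ThinModule.apply_eq_zero _ hx', eq_comm]
      refine Finset.sum_eq_zero fun y _ => ?_
      by_contra hne
      obtain ⟨hf, hu⟩ := mul_ne_zero_iff.1 hne
      rw [mk_apply] at hu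
      obtain ⟨hy', hu'⟩ := ite_ne_right_iff.1 hu
      have hy : S y := by
        by_contra hy
        exact hu' (ThinModule.apply_eq_zero u hy)
      exact hx' ((H x y hx hy (rel_of_apply_ne_zero hf)).2 hy')

theorem restrict_apply (H : ∀ x y, S' x → S y → R x y → (S x ↔ S' y)) (u : ThinModule K S)
    {x : V} (hx : S' x) : restrict K H u x = u x := if_pos hx

theorem restrict_basisVec (H : ∀ x y, S' x → S y → R x y → (S x ↔ S' y)) {x : V} (hx : S x)
    (hx' : S' x) : restrict K H (basisVec K S x) = basisVec K S' x := by
  ext y hy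
  rw [restrict_apply H _ hy]
  by_cases hyx : y = x
  · subst hyx; rw [basisVec_apply_self hx, basisVec_apply_self hx']
  · simp [basisVec_apply, hyx]

end ThinModule

/-! ### The Auslander algebra of the linear quiver as a thin algebra -/

/-- The grid of pairs in which the vertices `(a, b)`, `0 < a < b`, of the Auslander algebra of
type `A_n` are found. -/
abbrev Grid (n : ℕ) : Type := Fin (n + 2) × Fin (n + 2)

/-- The pairs of vertices between which the Auslander algebra of type `A_n` has a nonzero matrix
unit. The vertex `(a, b)` stands for the interval module with support `a, …, b - 1`. -/
def auslanderRel (n : ℕ) (p q : Grid n) : Prop :=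
  0 < p.1.val ∧ p.1.val ≤ q.1.val ∧ q.1.val < p.2.val ∧ p.2.val ≤ q.2.val

instance (n : ℕ) : IsThinRel (auslanderRel n) where
  refl_left h := by unfold auslanderRel at *; omega
  refl_right h := by unfold auslanderRel at *; omega
  trans_left h h' h'' h''' := by unfold auslanderRel at *; omega
  trans_right h h' h'' h''' := by unfold auslanderRel at *; omega
  antisymm h h' := by
    unfold auslanderRel at *
    ext <;> omega

/-- The Auslander algebra of the linearly oriented quiver of type `A_n`, as a thin algebra. -/
abbrev AuslanderAlg (K : Type u) [Field K] (n : ℕ) : Type u := ThinAlgebra K (auslanderRel n)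

/-- The rectangle of all `(a, b)` with `i < a ≤ j'` and `j < b ≤ k`; it is declared to be empty
unless `j' ≤ j`. -/
def rect {n : ℕ} (i j' j k : Fin (n + 2)) (p : Grid n) : Prop :=
  i.val < p.1.val ∧ p.1.val ≤ j'.val ∧ j.val < p.2.val ∧ p.2.val ≤ k.val ∧ j'.val ≤ j.val

instance {n : ℕ} (i j' j k : Fin (n + 2)) : IsThinSupport (auslanderRel n) (rect i j' j k) where
  refl h := by unfold rect auslanderRel at *; omega
  trans h h' h'' h''' := by unfold rect auslanderRel at *; omega

/-- The increasing triples, which index the summands of the cluster tilting module. -/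
abbrev Triple (n : ℕ) : Type :=
  {t : Fin (n + 2) × Fin (n + 2) × Fin (n + 2) // t.1.val < t.2.1.val ∧ t.2.1.val < t.2.2.val}

/-- The rectangle with corner `(j, j + 1)` at the diagonal that belongs to the triple
`(i, j, k)`. -/
abbrev cell {n : ℕ} (t : Triple n) : Grid n → Prop := rect t.1.1 t.1.2.1 t.1.2.1 t.1.2.2

namespace ThinModule

open ThinAlgebra

variable {K : Type u} [Field K] {n : ℕ}

theorem isGenerator_cell (t : Triple n) :
    IsGenerator (auslanderRel n) (cell t) (t.1.2.1, t.1.2.2) := by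
  obtain ⟨t, h1, h2⟩ := t
  refine ⟨?_, fun x hx => ?_⟩
  · simp only [rect]; omega
  · simp only [rect, auslanderRel] at *; omega

/-- Homomorphisms between the modules of triples only go up in all three coordinates. -/
theorem le_of_hom_cell_ne_zero {s t : Triple n}
    {F : ThinModule K (cell s) →ₗ[AuslanderAlg K n] ThinModule K (cell t)} (h : F ≠ 0) :
    s.1.1.val ≤ t.1.1.val ∧ s.1.2.1.val ≤ t.1.2.1.val ∧ s.1.2.2.val ≤ t.1.2.2.val := by
  have h1 := mem_of_hom_ne_zero (isGenerator_cell s) h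
  have h2 : s.1.1.val ≤ t.1.1.val := by
    by_contra hlt
    have hs := s.2
    have h3 := mem_of_rel_of_hom_ne_zero (isGenerator_cell s) h (z := (s.1.1, s.1.2.2))
      (by simp only [rect] at *; omega) (by simp only [rect, auslanderRel] at *; omega)
    simp only [rect] at h3; omega
  simp only [rect] at h1
  omega

/-- The condition on a module `X` that expresses the vanishing of the extensions of the modules of
triples by `X`: for all `0 < i < j < k`, the sequence `X_(j,k) → X_(i,k) → X_(i,j)` is exact. -/
def MiddleExact (K : Type u) [Field K] {n : ℕ} (X : Type*) [AddCommGroup X]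
    [Module (AuslanderAlg K n) X] : Prop :=
  ∀ i j k : Fin (n + 2), 0 < i.val → i.val < j.val → j.val < k.val → ∀ v : X,
    e K (auslanderRel n) (i, j) (i, k) • v = 0 →
    ∃ w : X, e K (auslanderRel n) (i, k) (j, k) • w = e K (auslanderRel n) (i, k) (i, k) • v

section Presentation

variable {i j k : Fin (n + 2)}

theorem isGenerator_rect {j' : Fin (n + 2)} (hij : i.val < j'.val) (hjj : j'.val ≤ j.val)
    (hjk : j.val < k.val) : IsGenerator (auslanderRel n) (rect i j' j k) (j', k) := by
  refine ⟨?_, fun x hx => ?_⟩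
  · simp only [rect]; omega
  · simp only [rect, auslanderRel] at *; omega

variable (K i j k) in
/-- The inclusion of the first syzygy of a rectangle module into its projective cover. -/
noncomputable def syzygyInclusion : ThinModule K (rect 0 i j k) →ₗ[AuslanderAlg K n]
    ThinModule K (rect 0 j j k) :=
  restrict K fun x y hx hy hxy => by
    simp only [rect, auslanderRel] at *; omega

variable (K i j k) in
/-- The projective cover of a rectangle module. -/
noncomputable def projectiveCover : ThinModule K (rect 0 j j k) →ₗ[AuslanderAlg K n]
    ThinModule K (rect i j j k) :=
  restrict K fun x y hx hy hxy => by
    simp only [rect, auslanderRel, Fin.val_zero] at *; omega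

theorem syzygyInclusion_injective (hij : i.val < j.val) :
    Function.Injective (syzygyInclusion K i j k) := by
  rw [injective_iff_map_eq_zero]
  intro u hu
  ext x hx
  have hx' : rect 0 j j k x := by simp only [rect] at *; omega
  rw [← restrict_apply (R := auslanderRel n) _ u hx']
  exact congrArg (fun w => w x) hu

theorem projectiveCover_surjective : Function.Surjective (projectiveCover K i j k) := by
  intro u
  refine ⟨ThinModule.mk u fun x hx => ThinModule.apply_eq_zero u fun h => hx ?_, ?_⟩
  · simp only [rect, Fin.val_zero] at *; omega
  · ext x hx
    rw [projectiveCover, restrict_apply _ _ hx, mk_apply]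

theorem exact_syzygyInclusion_projectiveCover (hij : i.val < j.val) :
    Function.Exact (syzygyInclusion K i j k) (projectiveCover K i j k) := by
  intro u
  constructor
  · intro hu
    refine ⟨ThinModule.mk u fun x hx => ?_, ?_⟩
    · by_cases h : rect 0 j j k x
      · have hx' : rect i j j k x := by simp only [rect] at *; omega
        rw [← restrict_apply (R := auslanderRel n) _ u hx']
        exact congrArg (fun w => w x) hu
      · exact ThinModule.apply_eq_zero u h
    · ext x hx
      rw [syzygyInclusion, restrict_apply _ _ hx, mk_apply]
  · rintro ⟨v, rfl⟩
    ext x hx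
    have hx' : rect 0 j j k x := by simp only [rect, Fin.val_zero] at *; omega
    rw [projectiveCover, restrict_apply _ _ hx, syzygyInclusion, restrict_apply _ _ hx', zero_apply]
    refine ThinModule.apply_eq_zero v fun h => ?_
    simp only [rect] at *; omega

end Presentation

section Ext

variable {X : ModuleCat.{u} (AuslanderAlg K n)}

theorem middleExact_of_extOneVanishes
    (h : ∀ t : Triple n,
      ExtOneVanishes (ModuleCat.of (AuslanderAlg K n) (ThinModule K (cell t))) X) :
    MiddleExact K (n := n) X := by
  let _ : Module K X := Module.restrictScalars K (AuslanderAlg K n) X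
  have : IsScalarTower K (AuslanderAlg K n) X := IsScalarTower.restrictScalars K _ X
  intro i j k hi hij hjk v hv
  have hΩ : IsGenerator (auslanderRel n) (rect 0 i j k) (i, k) :=
    isGenerator_rect hi hij.le hjk
  have hkill : ∀ x, ¬ rect 0 i j k x → e K (auslanderRel n) x (i, k) • v = 0 := by
    intro x hx
    by_cases hR : auslanderRel n x (i, k)
    · rw [← e_mul_e (y := (i, j)), mul_smul, hv, smul_zero]
      all_goals simp only [rect, auslanderRel, Fin.val_zero] at *; omega
    · rw [e_eq_zero hR, zero_smul]
  obtain ⟨F, hF⟩ := (h ⟨(i, j, k), hij, hjk⟩).exists_extension (syzygyInclusion_injective hij)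
    (exact_syzygyInclusion_projectiveCover hij) projectiveCover_surjective (lift hΩ v hkill)
  have hik : rect 0 j j k (i, k) := by simp only [rect, Fin.val_zero]; omega
  have hjk' : rect 0 j j k (j, k) := by simp only [rect, Fin.val_zero]; omega
  have hR : auslanderRel n (i, k) (j, k) := by simp only [auslanderRel]; omega
  refine ⟨F (basisVec K _ (j, k)), ?_⟩
  rw [← map_smul, e_smul_basisVec hR hjk', ← lift_basisVec hΩ v hkill hΩ.1, ← hF,
    LinearMap.comp_apply, syzygyInclusion, restrict_basisVec _ hΩ.1 hik]

theorem MiddleExact.extOneVanishes (h : MiddleExact K (n := n) X) (t : Triple n) :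
    ExtOneVanishes (ModuleCat.of (AuslanderAlg K n) (ThinModule K (cell t))) X := by
  let _ : Module K X := Module.restrictScalars K (AuslanderAlg K n) X
  have : IsScalarTower K (AuslanderAlg K n) X := IsScalarTower.restrictScalars K _ X
  obtain ⟨⟨i, j, k⟩, hij, hjk⟩ := t
  simp only at hij hjk
  have hP : IsGenerator (auslanderRel n) (rect 0 j j k) (j, k) :=
    isGenerator_rect (by rw [Fin.val_zero]; omega) le_rfl hjk
  have : Module.Projective (AuslanderAlg K n) (ThinModule K (rect 0 j j k)) :=
    projective_of_forall_rel hP fun x hx => by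
      simp only [rect, auslanderRel, Fin.val_zero] at *; omega
  refine extOneVanishes_of_projective (syzygyInclusion_injective hij)
    (exact_syzygyInclusion_projectiveCover hij) (projectiveCover_surjective (i := i)) fun F => ?_
  rcases Nat.eq_zero_or_pos i.val with hi | hi
  · refine ⟨0, ?_⟩
    ext1 u
    have : u = 0 := by
      ext x hx
      simp only [rect, Fin.val_zero] at hx; omega
    rw [this, map_zero, map_zero]
  · have hΩ : IsGenerator (auslanderRel n) (rect 0 i j k) (i, k) :=
      isGenerator_rect hi hij.le hjk
    have hij' : ¬ rect 0 i j k (i, j) := by simp only [rect]; omega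
    obtain ⟨w, hw⟩ := h i j k hi hij hjk (F (basisVec K _ (i, k))) (by
      rw [← map_smul, e_smul_of_notMem hij', map_zero])
    refine ⟨lift hP w fun x hx => ?_, hom_ext hΩ ?_⟩
    · rw [e_eq_zero, zero_smul]
      intro hR
      apply hx
      simp only [rect, auslanderRel, Fin.val_zero] at *; omega
    · have hik : rect 0 j j k (i, k) := by simp only [rect, Fin.val_zero]; omega
      have hRik : auslanderRel n (i, k) (i, k) := by simp only [auslanderRel]; omega
      rw [LinearMap.comp_apply, syzygyInclusion, restrict_basisVec _ hΩ.1 hik,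
        lift_basisVec _ _ _ hik, hw, ← map_smul, e_smul_basisVec hRik hΩ.1]

end Ext

end ThinModule

/-! ### Middle exact modules are sums of rectangle modules -/

namespace ThinModule

open ThinAlgebra

variable {K : Type u} [Field K] {n : ℕ}

theorem middleExact_cell (t : Triple n) : MiddleExact K (n := n) (ThinModule K (cell t)) := by
  intro i j k hi hij hjk v hv
  by_cases h : rect t.1.1 t.1.2.1 t.1.2.1 t.1.2.2 (i, j)
  · -- The second map is injective here.
    refine ⟨0, ?_⟩
    have hR : auslanderRel n (i, j) (i, k) := by simp only [auslanderRel]; omega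
    have h0 := congrArg (fun w => w (i, j)) hv
    simp only [e_smul_apply_self hR h, zero_apply] at h0
    rw [smul_zero, eq_comm]
    ext x hx
    rw [e_smul_apply, h0, ite_self, zero_apply]
  · by_cases h' : cell t (i, k)
    · -- The first map is bijective here.
      have hjk' : cell t (j, k) := by simp only [rect] at *; omega
      refine ⟨v (i, k) • basisVec K _ (j, k), ?_⟩
      have hR : auslanderRel n (i, k) (j, k) := by simp only [auslanderRel]; omega
      rw [smul_comm, e_smul_basisVec hR hjk']
      ext x hx
      by_cases hxi : x = (i, k)
      · subst hxi
        rw [smul_apply, basisVec_apply_self h', e_smul_apply_self (IsThinRel.refl_left hR) h',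
          mul_one]
      · simp [basisVec_apply, e_smul_apply, hxi]
    · exact ⟨0, by rw [smul_zero, e_smul_of_notMem h']⟩

theorem MiddleExact.of_retract {X Y : Type*} [AddCommGroup X] [Module (AuslanderAlg K n) X]
    [AddCommGroup Y] [Module (AuslanderAlg K n) Y] (hX : MiddleExact K (n := n) X)
    (i : Y →ₗ[AuslanderAlg K n] X) (p : X →ₗ[AuslanderAlg K n] Y) (hpi : p ∘ₗ i = LinearMap.id) :
    MiddleExact K (n := n) Y := by
  intro a b c ha hab hbc v hv
  obtain ⟨w, hw⟩ := hX a b c ha hab hbc (i v) (by rw [← map_smul, hv, map_zero])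
  refine ⟨p w, ?_⟩
  rw [← map_smul, hw, map_smul]
  exact congrArg _ (congrArg (fun f => f v) hpi)

/-- The family of rectangle modules, enumerated by `c`. -/
noncomputable abbrev cellFamily (K : Type u) [Field K] {n t : ℕ} (c : Fin t → Triple n)
    (l : Fin t) : ModuleCat.{u} (AuslanderAlg K n) :=
  ModuleCat.of (AuslanderAlg K n) (ThinModule K (cell (c l)))

theorem middleExact_of_id_mem_endosThrough {t : ℕ} {c : Fin t → Triple n} {X : Type u}
    [AddCommGroup X] [Module (AuslanderAlg K n) X]
    (h : LinearMap.id ∈ endosThrough (cellFamily K c) X) : MiddleExact K (n := n) X := by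
  intro i j k hi hij hjk v hv
  have key : ∀ g ∈ endosThrough (cellFamily K c) X, ∃ w : X,
      e K (auslanderRel n) (i, k) (j, k) • w = e K (auslanderRel n) (i, k) (i, k) • g v := by
    intro g hg
    induction hg using AddSubmonoid.closure_induction with
    | mem g hg =>
      obtain ⟨l, a, b, rfl⟩ := hg
      obtain ⟨w, hw⟩ := middleExact_cell (K := K) (c l) i j k hi hij hjk (a v)
        (by rw [← map_smul, hv, map_zero])
      exact ⟨b w, by rw [← map_smul, hw, map_smul, LinearMap.comp_apply]⟩
    | zero => exact ⟨0, by simp⟩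
    | add g h _ _ ihg ihh =>
      obtain ⟨w, hw⟩ := ihg
      obtain ⟨w', hw'⟩ := ihh
      exact ⟨w + w', by rw [smul_add, hw, hw', LinearMap.add_apply, smul_add]⟩
  exact key _ h

section Decomposition

variable {X : Type*} [AddCommGroup X] [Module (AuslanderAlg K n) X] [Module K X]
  [IsScalarTower K (AuslanderAlg K n) X]

/-- A nonzero middle exact module `X` has a direct summand that is a rectangle module. Let `p` be
minimal such that the row of `p` meets the support of `X`, then `q` minimal such that `(p, q)` lies
in this support and `k` maximal such that `X_(p,k) → X_(p,q)` is nonzero. Exactness allows to lift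
an element of `X_(p,k)` with nonzero image to `X_(q-1,k)`, and this lift generates a summand that
belongs to the triple `(p - 1, q - 1, k)`. -/
theorem MiddleExact.exists_retract_cell (hX : MiddleExact K (n := n) X) [Nontrivial X] :
    ∃ (t : Triple n) (f : ThinModule K (cell t) →ₗ[AuslanderAlg K n] X)
      (g : X →ₗ[AuslanderAlg K n] ThinModule K (cell t)), g ∘ₗ f = LinearMap.id := by
  classical
  have hp : ∃ p : ℕ, ∃ x : Grid n, x.1.val = p ∧ ∃ v : X, e K (auslanderRel n) x x • v ≠ 0 := by
    obtain ⟨v, hv⟩ := exists_ne (0 : X)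
    obtain ⟨x, hx⟩ := exists_e_smul_ne_zero (K := K) (R := auslanderRel n) hv
    exact ⟨_, x, rfl, v, hx⟩
  have hq : ∃ q : ℕ, ∃ x : Grid n, x.1.val = Nat.find hp ∧ x.2.val = q ∧
      ∃ v : X, e K (auslanderRel n) x x • v ≠ 0 := by
    obtain ⟨x, hx, v, hv⟩ := Nat.find_spec hp
    exact ⟨_, x, hx, rfl, v, hv⟩
  obtain ⟨⟨p, q⟩, hpx, hqx, hpq⟩ := Nat.find_spec hq
  simp only at hpx hqx
  have hpmin : ∀ x : Grid n, x.1.val < p.val → ∀ v : X, e K (auslanderRel n) x x • v = 0 := by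
    intro x hx v
    by_contra hv
    exact Nat.find_min hp (hpx ▸ hx) ⟨x, rfl, v, hv⟩
  have hqmin : ∀ b : Fin (n + 2), b.val < q.val → ∀ v : X,
      e K (auslanderRel n) (p, b) (p, b) • v = 0 := by
    intro b hb v
    by_contra hv
    exact Nat.find_min hq (hqx ▸ hb) ⟨(p, b), hpx, rfl, v, hv⟩
  have hRpq : auslanderRel n (p, q) (p, q) := by
    obtain ⟨v, hv⟩ := hpq
    by_contra h
    exact hv (by rw [e_eq_zero h, zero_smul])
  -- The maximal `k` such that `X_(p,k) → X_(p,q)` is nonzero.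
  obtain ⟨k, hk, hkmax⟩ := Finset.exists_max_image
    (Finset.univ.filter fun k : Fin (n + 2) => ∃ v : X, e K (auslanderRel n) (p, q) (p, k) • v ≠ 0)
    (fun k => k.val) ⟨q, by simpa using hpq⟩
  obtain ⟨v₀, hv₀⟩ := (Finset.mem_filter.1 hk).2
  have hkmax' : ∀ d : Fin (n + 2), k.val < d.val → ∀ v : X,
      e K (auslanderRel n) (p, q) (p, d) • v = 0 := by
    intro d hd v
    by_contra hv
    have := hkmax d (by simpa using ⟨v, hv⟩)
    omega
  have hRk : auslanderRel n (p, q) (p, k) := by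
    by_contra h
    exact hv₀ (by rw [e_eq_zero h, zero_smul])
  simp only [auslanderRel] at hRpq hRk
  obtain ⟨i, hi⟩ : ∃ i : Fin (n + 2), i.val + 1 = p.val := ⟨⟨p.val - 1, by omega⟩, by simp; omega⟩
  obtain ⟨j, hj⟩ : ∃ j : Fin (n + 2), j.val + 1 = q.val := ⟨⟨q.val - 1, by omega⟩, by simp; omega⟩
  -- The lift of `v₀`.
  obtain ⟨v, hv⟩ : ∃ v : X, e K (auslanderRel n) (p, k) (j, k) • v =
      e K (auslanderRel n) (p, k) (p, k) • v₀ := by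
    rcases Nat.lt_or_ge p.val j.val with hpj | hpj
    · refine hX p j k (by omega) hpj (by omega) v₀ ?_
      rw [← e_self_mul_e, mul_smul, hqmin j (by omega)]
    · have : p = j := Fin.ext (by omega)
      subst this
      exact ⟨v₀, rfl⟩
  let t : Triple n := ⟨(i, j, k), by simp only; omega⟩
  have hkill : ∀ x, ¬ cell t x → e K (auslanderRel n) x (j, k) • v = 0 := by
    intro x hx
    by_cases hR : auslanderRel n x (j, k)
    · rw [← e_self_mul_e, mul_smul, hpmin x (by simp only [t, rect, auslanderRel] at *; omega)]
    · rw [e_eq_zero hR, zero_smul]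
  have hsocle : ∀ x, cell t x → auslanderRel n (p, q) x := by
    intro x hx
    simp only [t, rect, auslanderRel] at *; omega
  have hcokill : ∀ x, ¬ cell t x → ∀ w : X, e K (auslanderRel n) (p, q) x • w = 0 := by
    intro x hx w
    by_cases hR : auslanderRel n (p, q) x
    · rw [← e_mul_e (y := (p, x.2)), mul_smul,
        hkmax' x.2 (by simp only [t, rect, auslanderRel] at *; omega)]
      all_goals simp only [auslanderRel] at *; omega
    · rw [e_eq_zero hR, zero_smul]
  have hne : e K (auslanderRel n) (p, q) (j, k) • v ≠ 0 := by
    rw [← e_mul_e (y := (p, k)), mul_smul, hv, ← mul_smul, e_mul_e_self]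
    · exact hv₀
    all_goals simp only [auslanderRel] at *; omega
  obtain ⟨l, hl⟩ : ∃ l : X →ₗ[K] K, l (e K (auslanderRel n) (p, q) (j, k) • v) = 1 := by
    obtain ⟨l, hl⟩ := not_forall.1 fun h => hne ((Module.forall_dual_apply_eq_zero_iff K _).1 h)
    exact ⟨(l (e K (auslanderRel n) (p, q) (j, k) • v))⁻¹ • l, by
      rw [LinearMap.smul_apply, smul_eq_mul, inv_mul_cancel₀ hl]⟩
  refine ⟨t, lift (isGenerator_cell t) v hkill,
    colift hsocle l fun x hx w => by rw [hcokill x hx w, map_zero], ?_⟩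
  ext1 u
  rw [LinearMap.comp_apply, colift_lift, LinearMap.id_apply]
  exact (congrArg (· • u) hl).trans (one_smul K u)

end Decomposition

/-- Middle exact modules of finite dimension are direct sums of rectangle modules: split off one
rectangle module after the other. -/
theorem MiddleExact.id_mem_endosThrough {t : ℕ} (c : Fin t ≃ Triple n) :
    ∀ (d : ℕ) (X : Type u) [AddCommGroup X] [Module (AuslanderAlg K n) X] [Module K X]
      [IsScalarTower K (AuslanderAlg K n) X] [Module.Finite K X], Module.finrank K X = d →
      MiddleExact K (n := n) X → LinearMap.id ∈ endosThrough (cellFamily K c) X := by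
  intro d
  induction d using Nat.strong_induction_on with
  | _ d ih =>
  intro X _ _ _ _ _ hd hX
  rcases subsingleton_or_nontrivial X with hs | hs
  · rw [Subsingleton.elim (LinearMap.id : X →ₗ[AuslanderAlg K n] X) 0]
    exact zero_mem _
  · obtain ⟨s, f, g, hgf⟩ := hX.exists_retract_cell
    have hgf' : ∀ u, g (f u) = u := fun u => congrArg (fun F => F u) hgf
    -- The complement of the summand found.
    let i : LinearMap.ker g →ₗ[AuslanderAlg K n] X := (LinearMap.ker g).subtype
    let p : X →ₗ[AuslanderAlg K n] LinearMap.ker g :=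
      (LinearMap.id - f ∘ₗ g).codRestrict (LinearMap.ker g) fun x => by simp [hgf']
    have hpi : p ∘ₗ i = LinearMap.id := by
      ext x
      simp [p, i]
    have hsum : (LinearMap.id : X →ₗ[AuslanderAlg K n] X) =
        f ∘ₗ g + i ∘ₗ LinearMap.id ∘ₗ p := by
      ext x
      simp [p, i]
    have hlt : Module.finrank K (LinearMap.ker g) < d := by
      have h1 := LinearMap.finrank_range_add_finrank_ker (g.restrictScalars K)
      have h2 : LinearMap.range (g.restrictScalars K) = ⊤ :=
        LinearMap.range_eq_top.2 fun u => ⟨f u, hgf' u⟩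
      have h3 : 0 < Module.finrank K (ThinModule K (cell s)) :=
        Module.finrank_pos_iff_exists_ne_zero.2 ⟨_, basisVec_ne_zero (isGenerator_cell s).1⟩
      have h4 : Module.finrank K (LinearMap.ker g) =
        Module.finrank K (LinearMap.ker (g.restrictScalars K)) := rfl
      rw [h2, finrank_top] at h1
      omega
    have hfin : Module.Finite K (LinearMap.ker g) :=
      inferInstanceAs (Module.Finite K (LinearMap.ker (g.restrictScalars K)))
    rw [hsum]
    refine add_mem ?_ (comp_comp_mem_endosThrough p i
      (ih _ hlt (LinearMap.ker g) rfl (hX.of_retract i p hpi)))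
    obtain ⟨l, rfl⟩ := c.surjective s
    exact comp_mem_endosThrough (θ := cellFamily K c) (c := l) g f

end ThinModule

/-! ### The cluster tilting module -/

namespace ThinModule

open ThinAlgebra

variable {K : Type u} [Field K] {n t : ℕ}

/-- The sum of all rectangle modules. -/
abbrev CellSum (K : Type u) [Field K] (c : Fin t ≃ Triple n) : Type u :=
  ∀ l, ThinModule K (cell (c l))

section Approximation

variable (c : Fin t ≃ Triple n) {X : Type u} [AddCommGroup X] [Module (AuslanderAlg K n) X]
  [Module K X] [IsScalarTower K (AuslanderAlg K n) X] [Module.Finite K X]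

/-- Every finite-dimensional module has a right approximation by a multiple of the sum of all
rectangle modules. The stated property says that homomorphisms from rectangle modules, given by
elements `v` that are killed by a matrix unit, lift along the approximation. -/
theorem exists_approximation : ∃ (d : ℕ) (F : (Fin d → CellSum K c) →ₗ[AuslanderAlg K n] X),
    ∀ i j k : Fin (n + 2), i.val < j.val → j.val < k.val → ∀ v : X,
      e K (auslanderRel n) (i, k) (j, k) • v = 0 →
      ∃ w, F w = e K (auslanderRel n) (j, k) (j, k) • v ∧
        e K (auslanderRel n) (i, k) (j, k) • w = 0 := by
  have hfin : Module.Finite K (CellSum K c →ₗ[AuslanderAlg K n] X) := by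
    let φ : (CellSum K c →ₗ[AuslanderAlg K n] X) →ₗ[K] (CellSum K c →ₗ[K] X) :=
      { toFun := fun f => f.restrictScalars K
        map_add' := fun _ _ => rfl
        map_smul' := fun _ _ => rfl }
    exact Module.Finite.of_injective φ (LinearMap.restrictScalars_injective K)
  obtain ⟨d, f, hf⟩ := Module.Finite.exists_fin (R := K) (M := CellSum K c →ₗ[AuslanderAlg K n] X)
  refine ⟨d, ∑ a, f a ∘ₗ LinearMap.proj a, ?_⟩
  intro i j k hij hjk v hv
  obtain ⟨l, hl⟩ := c.surjective ⟨(i, j, k), hij, hjk⟩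
  have hg : IsGenerator (auslanderRel n) (cell (c l)) (j, k) := by
    rw [hl]; exact isGenerator_cell _
  have hikl : ¬ cell (c l) (i, k) := by
    rw [hl]; simp only [rect]; omega
  have hkill : ∀ x, ¬ cell (c l) x → e K (auslanderRel n) x (j, k) • v = 0 := by
    intro x hx
    rw [hl] at hx
    by_cases hR : auslanderRel n x (j, k)
    · rw [← e_mul_e (y := (i, k)), mul_smul, hv, smul_zero]
      all_goals simp only [rect, auslanderRel] at *; omega
    · rw [e_eq_zero hR, zero_smul]
  have hmem : lift hg v hkill ∘ₗ LinearMap.proj l ∈ Submodule.span K (Set.range f) :=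
    hf ▸ Submodule.mem_top
  obtain ⟨b, hb⟩ := (Submodule.mem_span_range_iff_exists_fun K).1 hmem
  let δ : CellSum K c := Pi.single l (basisVec K _ (j, k))
  refine ⟨fun a => b a • δ, ?_, ?_⟩
  · have h1 := congrArg (fun F => F δ) hb
    simp only [LinearMap.sum_apply, LinearMap.smul_apply, LinearMap.comp_apply,
      LinearMap.proj_apply, δ, Pi.single_eq_same] at h1
    rw [lift_basisVec hg v hkill hg.1] at h1
    rw [← h1]
    simp only [LinearMap.sum_apply, LinearMap.comp_apply, LinearMap.proj_apply]
    exact Finset.sum_congr rfl fun a _ => LinearMap.map_smul_of_tower _ _ _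
  · ext1 a
    rw [Pi.smul_apply, smul_comm]
    have : e K (auslanderRel n) (i, k) (j, k) • δ = 0 := by
      ext1 l'
      rw [Pi.smul_apply]
      by_cases h : l' = l
      · subst h
        exact e_smul_of_notMem hikl _
      · rw [show δ l' = 0 from Pi.single_eq_of_ne h _, smul_zero]; rfl
    rw [this, smul_zero]; rfl

/-- The approximation is surjective because the projective modules are rectangle modules, and its
kernel is middle exact. -/
theorem exists_surjective_middleExact_ker :
    ∃ (d : ℕ) (F : (Fin d → CellSum K c) →ₗ[AuslanderAlg K n] X),
      Function.Surjective F ∧ MiddleExact K (n := n) (LinearMap.ker F) := by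
  obtain ⟨d, F, hF⟩ := exists_approximation (K := K) c (X := X)
  refine ⟨d, F, ?_, ?_⟩
  · rw [← LinearMap.range_eq_top, eq_top_iff]
    rintro v -
    rw [← sum_e_smul (K := K) (R := auslanderRel n) v]
    refine sum_mem fun x _ => ?_
    by_cases hx : auslanderRel n x x
    · simp only [auslanderRel] at hx
      obtain ⟨w, hw, -⟩ := hF 0 x.1 x.2 (by rw [Fin.val_zero]; omega) (by omega) v (by
        rw [e_eq_zero, zero_smul]
        simp only [auslanderRel, Fin.val_zero]; omega)
      exact ⟨w, hw⟩
    · rw [e_eq_zero hx, zero_smul]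
      exact zero_mem _
  · intro i j k hi hij hjk v hv
    have hM : MiddleExact K (n := n) (Fin d → CellSum K c) :=
      middleExact_of_id_mem_endosThrough (c := c) ((inAdd_iff_id_mem_endosThrough
        (X := ModuleCat.of _ (Fin d → CellSum K c))).1 ⟨d, LinearMap.id, LinearMap.id, rfl⟩)
    have hRik : auslanderRel n (i, k) (j, k) := by simp only [auslanderRel]; omega
    obtain ⟨w₀, hw₀⟩ := hM i j k hi hij hjk v (congrArg Subtype.val hv)
    obtain ⟨w₁, hw₁, hw₁'⟩ := hF i j k hij hjk (F w₀) (by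
      rw [← map_smul, hw₀, map_smul, LinearMap.mem_ker.1 v.2, smul_zero])
    refine ⟨⟨e K (auslanderRel n) (j, k) (j, k) • w₀ - w₁, ?_⟩, Subtype.ext ?_⟩
    · rw [LinearMap.mem_ker, map_sub, map_smul, hw₁, sub_self]
    · change e K (auslanderRel n) (i, k) (j, k) • (e K (auslanderRel n) (j, k) (j, k) • w₀ - w₁) =
        e K (auslanderRel n) (i, k) (i, k) • v.1
      rw [smul_sub, hw₁', sub_zero, ← mul_smul, e_mul_e_self, hw₀]

end Approximation

/-- For a finitely generated module `X`, lying in `add` of the sum of all rectangle modules, being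
middle exact and having no extensions by rectangle modules on either side are all equivalent. -/
theorem isTwoClusterTilting (c : Fin t ≃ Triple n) :
    IsTwoClusterTilting (ModuleCat.of (AuslanderAlg K n) (∀ l, cellFamily K c l)) := by
  refine ⟨inferInstanceAs (Module.Finite (AuslanderAlg K n) (CellSum K c)), fun X hX => ?_⟩
  let _ : Module K X := Module.restrictScalars K (AuslanderAlg K n) X
  have : IsScalarTower K (AuslanderAlg K n) X := IsScalarTower.restrictScalars K _ X
  have : Module.Finite K X := Module.Finite.trans (AuslanderAlg K n) X
  have hadd : ∀ Y : ModuleCat.{u} (AuslanderAlg K n),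
      InAdd (ModuleCat.of (AuslanderAlg K n) (∀ l, cellFamily K c l)) Y →
      MiddleExact K (n := n) Y := fun Y hY =>
    middleExact_of_id_mem_endosThrough (inAdd_iff_id_mem_endosThrough.1 hY)
  have hext : ∀ Y Z : ModuleCat.{u} (AuslanderAlg K n), MiddleExact K (n := n) Z →
      InAdd (ModuleCat.of (AuslanderAlg K n) (∀ l, cellFamily K c l)) Y →
      ExtOneVanishes Y Z := fun Y Z hZ hY =>
    extOneVanishes_of_id_mem_endosThrough (inAdd_iff_id_mem_endosThrough.1 hY) fun l =>
      hZ.extOneVanishes (c l)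
  have hmid : MiddleExact K (n := n) X →
      InAdd (ModuleCat.of (AuslanderAlg K n) (∀ l, cellFamily K c l)) X := fun h =>
    inAdd_iff_id_mem_endosThrough.2 (MiddleExact.id_mem_endosThrough c _ X rfl h)
  refine ⟨⟨fun h Y hY => hext X Y (hadd Y hY) h, fun h => ?_⟩,
    ⟨fun h Y hY => hext Y X (hadd X h) hY, fun h => hmid ?_⟩⟩
  · obtain ⟨d, F, hF, hker⟩ := exists_surjective_middleExact_ker (K := K) c (X := X)
    have hfin : Module.Finite K (LinearMap.ker F) :=
      inferInstanceAs (Module.Finite K (LinearMap.ker (F.restrictScalars K)))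
    have hY : InAdd (ModuleCat.of (AuslanderAlg K n) (∀ l, cellFamily K c l))
        (ModuleCat.of (AuslanderAlg K n) (LinearMap.ker F)) :=
      inAdd_iff_id_mem_endosThrough.2
        (MiddleExact.id_mem_endosThrough c _ (LinearMap.ker F) rfl hker)
    obtain ⟨s, hs⟩ := (h _ hY).exists_section (f := (LinearMap.ker F).subtype)
      (LinearMap.ker F).injective_subtype (LinearMap.exact_subtype_ker_map F) hF
    exact ⟨d, s, F, hs⟩
  · refine middleExact_of_extOneVanishes fun s => h _ ?_
    obtain ⟨l, rfl⟩ := c.surjective s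
    exact inAdd_iff_id_mem_endosThrough.2
      (comp_mem_endosThrough (θ := cellFamily K c) (c := l) LinearMap.id LinearMap.id)

end ThinModule

/-! ### The stratifying system -/

namespace ThinModule

open ThinAlgebra

variable {K : Type u} [Field K] {n t : ℕ}

/-- The lexicographic order on the summands of the cluster tilting module. -/
abbrev lexOrder (c : Fin t ≃ Triple n) : LinearOrder (Fin t) :=
  LinearOrder.lift' (fun l => toLex ((c l).1.1, toLex ((c l).1.2.1, (c l).1.2.2)))
    fun l l' h => c.injective <| Subtype.ext <| by
      have h1 := congrArg (fun x => (ofLex x).1) h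
      have h2 := congrArg (fun x => (ofLex (ofLex x).2).1) h
      have h3 := congrArg (fun x => (ofLex (ofLex x).2).2) h
      exact Prod.ext h1 (Prod.ext h2 h3)

theorem lexOrder_le_of_hom_ne_zero (c : Fin t ≃ Triple n) {l l' : Fin t}
    {F : ThinModule K (cell (c l)) →ₗ[AuslanderAlg K n] ThinModule K (cell (c l'))} (h : F ≠ 0) :
    (lexOrder c).le l l' := by
  obtain ⟨h1, h2, h3⟩ := le_of_hom_cell_ne_zero h
  exact Prod.Lex.toLex_mono ⟨h1, Prod.Lex.toLex_mono ⟨h2, h3⟩⟩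

theorem extOneVanishes_cell (s t : Triple n) :
    ExtOneVanishes (ModuleCat.of (AuslanderAlg K n) (ThinModule K (cell s)))
      (ModuleCat.of (AuslanderAlg K n) (ThinModule K (cell t))) :=
  MiddleExact.extOneVanishes (middleExact_cell t) s

theorem isStratifyingSystem (c : Fin t ≃ Triple n) :
    IsStratifyingSystem (cellFamily K c) (lexOrder c) where
  finite l := inferInstanceAs (Module.Finite (AuslanderAlg K n) (ThinModule K (cell (c l))))
  indecomposable l := ThinModule.indecomposable (isGenerator_cell (c l))
  hom_eq_zero i j hij f := by
    by_contra hf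
    refine absurd (lexOrder_le_of_hom_ne_zero c (F := f.hom) fun h => hf ?_)
      ((lexOrder c).lt_iff_le_not_ge _ _ |>.1 hij).2
    exact ModuleCat.hom_ext h
  ext_vanishes i j _ := extOneVanishes_cell (c j) (c i)

/-- An idempotent in the Jacobson radical vanishes. -/
theorem eq_zero_of_mem_jacobson {E : Type*} [Ring E] {x : E} (hx : x ∈ Ring.jacobson E)
    (h : x * x = x) : x = 0 := by
  rw [← Ideal.jacobson_bot] at hx
  obtain ⟨s, hs⟩ := Ideal.exists_mul_add_sub_mem_of_mem_jacobson (-x) (neg_mem hx)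
  have hs' : s * (-x + 1) = 1 := sub_eq_zero.1 hs
  calc x = s * (-x + 1) * x := by rw [hs', one_mul]
    _ = s * (x - x * x) := by rw [mul_assoc]; congr 1; noncomm_ring
    _ = 0 := by rw [h, sub_self, mul_zero]

theorem lexOrder_lt_of_endQuiverArrow (c : Fin t ≃ Triple n) {i j : Fin t}
    (h : EndQuiverArrow (cellFamily K c) i j) : (lexOrder c).lt i j := by
  obtain ⟨f, hf, hfJ⟩ := h
  let F : ThinModule K (cell (c i)) →ₗ[AuslanderAlg K n] ThinModule K (cell (c j)) :=
    LinearMap.proj j ∘ₗ f ∘ₗ LinearMap.single (AuslanderAlg K n) (fun l => cellFamily K c l) i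
  have hcomp : summandIdempotent (cellFamily K c) j * f * summandIdempotent (cellFamily K c) i =
      LinearMap.single (AuslanderAlg K n) (fun l => cellFamily K c l) j ∘ₗ F ∘ₗ
        LinearMap.proj i := rfl
  have hF : F ≠ 0 := by
    intro h0
    apply hfJ
    rw [hcomp, h0, LinearMap.zero_comp, LinearMap.comp_zero]
    exact zero_mem _
  have hle := lexOrder_le_of_hom_ne_zero c hF
  have hne : i ≠ j := by
    rintro rfl
    -- A nonzero endomorphism of a summand is a scalar, so the radical would contain the idempotent.
    have hg := isGenerator_cell (c i)
    set a := F (basisVec K (cell (c i)) ((c i).1.2.1, (c i).1.2.2)) ((c i).1.2.1, (c i).1.2.2)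
      with ha
    have ha0 : a ≠ 0 := fun h0 => hF (hom_eq_zero_of_apply hg h0)
    have hmem : summandIdempotent (cellFamily K c) i * f * summandIdempotent (cellFamily K c) i ∈
        Ring.jacobson (Module.End (AuslanderAlg K n) (∀ k, cellFamily K c k)) :=
      Ideal.mul_mem_right _ _ (Ideal.mul_mem_left _ _ hf)
    let r : Module.End (AuslanderAlg K n) (∀ k, cellFamily K c k) :=
      (LinearMap.single (AuslanderAlg K n) (fun l => cellFamily K c l) i ∘ₗ
        (a⁻¹ • (LinearMap.id : ThinModule K (cell (c i)) →ₗ[AuslanderAlg K n] _)) ∘ₗ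
        LinearMap.proj i)
    have hr : r * (summandIdempotent (cellFamily K c) i * f *
        summandIdempotent (cellFamily K c) i) = summandIdempotent (cellFamily K c) i := by
      rw [hcomp]
      refine LinearMap.ext fun u => ?_
      change Pi.single i (a⁻¹ • (Pi.single (M := fun l => ThinModule K (cell (c l))) i
        (F (u i)) i)) =
        Pi.single (M := fun l => ThinModule K (cell (c l))) i (u i)
      rw [Pi.single_eq_same, end_eq_smul hg F, ← ha, smul_smul, inv_mul_cancel₀ ha0, one_smul]
    have hidem := eq_zero_of_mem_jacobson (hr ▸ Ideal.mul_mem_left _ r hmem) (by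
      refine LinearMap.ext fun u => ?_
      change Pi.single i (Pi.single (M := fun l => ThinModule K (cell (c l))) i (u i) i) =
        Pi.single (M := fun l => ThinModule K (cell (c l))) i (u i)
      rw [Pi.single_eq_same])
    have h1 := congrArg (fun G => G (Pi.single i (basisVec K _ ((c i).1.2.1, (c i).1.2.2))) i) hidem
    refine basisVec_ne_zero (K := K) hg.1 ?_
    change Pi.single (M := fun l => ThinModule K (cell (c l))) i
      (Pi.single (M := fun l => ThinModule K (cell (c l))) i _ i) i = 0 at h1
    rwa [Pi.single_eq_same, Pi.single_eq_same] at h1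
  exact @lt_of_le_of_ne _ (lexOrder c).toPartialOrder _ _ hle hne

end ThinModule

/-! ### Counting vertices and summands -/

/-- Sorting increasing triples by their entries from the largest to the smallest. -/
def tripleEquiv (n : ℕ) :
    Triple n ≃ Σ k : Fin (n + 2), Σ j : Fin k.val, Fin j.val where
  toFun t := ⟨t.1.2.2, ⟨t.1.2.1.val, t.2.2⟩, ⟨t.1.1.val, t.2.1⟩⟩
  invFun s := ⟨(⟨s.2.2.val, by omega⟩, ⟨s.2.1.val, by omega⟩, s.1), s.2.2.2, s.2.1.2⟩
  left_inv _ := rfl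
  right_inv _ := rfl

theorem card_triple (n : ℕ) : 6 * Fintype.card (Triple n) = n * (n + 1) * (n + 2) := by
  have key : ∀ N : ℕ, 6 * ∑ k ∈ Finset.range (N + 2), ∑ j ∈ Finset.range k, j =
      N * (N + 1) * (N + 2) := by
    intro N
    induction N with
    | zero => simp [Finset.sum_range_succ]
    | succ N ih =>
      have h2 := Finset.sum_range_id_mul_two (N + 2)
      rw [Finset.sum_range_succ, mul_add, ih]
      rw [Nat.add_sub_assoc (by norm_num)] at h2
      norm_num at h2
      linarith
  rw [Fintype.card_congr (tripleEquiv n), Fintype.card_sigma]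
  simp only [Fintype.card_sigma, Fintype.card_fin]
  rw [← key n, Finset.sum_range fun k => ∑ j ∈ Finset.range k, j]
  simp only [Finset.sum_range fun j => j]

/-- The vertices of the Auslander algebra, shifted and sorted by their second entry. -/
def vertexEquiv (n : ℕ) :
    {x : Grid n // auslanderRel n x x} ≃ Σ b : Fin (n + 1), Fin b.val where
  toFun x := ⟨⟨x.1.2.val - 1, by omega⟩, ⟨x.1.1.val - 1, by
    have := x.2; simp only [auslanderRel] at *; omega⟩⟩
  invFun s := ⟨(⟨s.2.val + 1, by omega⟩, ⟨s.1.val + 1, by omega⟩), by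
    simp only [auslanderRel]; omega⟩
  left_inv x := by
    have := x.2
    simp only [auslanderRel] at this
    ext <;> simp only <;> omega
  right_inv s := rfl

theorem card_vertices (n : ℕ) [Fintype {x : Grid n // auslanderRel n x x}] :
    2 * Fintype.card {x : Grid n // auslanderRel n x x} = n * (n + 1) := by
  rw [Fintype.card_congr (vertexEquiv n), Fintype.card_sigma]
  simp only [Fintype.card_fin]
  rw [← Finset.sum_range fun b => b, mul_comm, Finset.sum_range_id_mul_two]
  simp [mul_comm]

/-! ### The path algebra of the linear quiver as a thin algebra -/

namespace LinearQuiver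

variable {n : ℕ}

/-- The position of a vertex, as a natural number less than `n`. -/
def pos (a : LinearQuiver n) : ℕ := Fin.val (n := n) a

theorem pos_lt (a : LinearQuiver n) : a.pos < n := Fin.isLt (n := n) a

theorem pos_injective {a b : LinearQuiver n} (h : a.pos = b.pos) : a = b := Fin.ext h

theorem exists_pos_eq {k : ℕ} (hk : k < n) : ∃ a : LinearQuiver n, a.pos = k :=
  ⟨(⟨k, hk⟩ : Fin n), rfl⟩

theorem length_add_pos {a b : LinearQuiver n} (p : Quiver.Path a b) :
    p.length + a.pos = b.pos := by
  induction p with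
  | nil => simp
  | cons p e ih =>
    have : pos _ + 1 = pos _ := e.down
    rw [Quiver.Path.length_cons]
    omega

theorem pos_le_of_path {a b : LinearQuiver n} (p : Quiver.Path a b) : a.pos ≤ b.pos := by
  have := length_add_pos p
  omega

theorem nonempty_path {a b : LinearQuiver n} (h : a.pos ≤ b.pos) :
    Nonempty (Quiver.Path a b) := by
  obtain ⟨d, hd⟩ := Nat.exists_eq_add_of_le h
  induction d generalizing b with
  | zero =>
    obtain rfl : a = b := pos_injective hd.symm
    exact ⟨Quiver.Path.nil⟩
  | succ d ih =>
    obtain ⟨c, hc⟩ := exists_pos_eq (n := n) (k := a.pos + d) (by have := b.pos_lt; omega)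
    obtain ⟨p⟩ := ih (b := c) (by omega) hc
    exact ⟨p.cons ⟨by change c.pos + 1 = b.pos; omega⟩⟩

instance (a b : LinearQuiver n) : Subsingleton (a ⟶ b) :=
  inferInstanceAs (Subsingleton (PLift (Fin.val (n := n) a + 1 = Fin.val (n := n) b)))

instance (a b : LinearQuiver n) : Subsingleton (Quiver.Path a b) := by
  refine ⟨fun p => ?_⟩
  induction p with
  | nil =>
    intro q
    have h := length_add_pos q
    exact (Quiver.Path.eq_nil_of_length_zero q (by omega)).symm
  | @cons c d p e ih =>
    intro q
    cases q with
    | nil =>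
      have h := length_add_pos (p.cons e)
      rw [Quiver.Path.length_cons] at h
      omega
    | @cons c' _ q e' =>
      have h1 : c.pos + 1 = d.pos := e.down
      have h2 : c'.pos + 1 = d.pos := e'.down
      obtain rfl : c = c' := pos_injective (by omega)
      rw [ih q, Subsingleton.elim e e']

end LinearQuiver

open LinearQuiver

/-- The pairs of vertices that are connected by a path. -/
def pathRel (n : ℕ) (a b : LinearQuiver n) : Prop := a.pos ≤ b.pos

instance (n : ℕ) : IsThinRel (pathRel n) where
  refl_left _ := le_refl _
  refl_right _ := le_refl _
  trans_left h h' _ _ := le_trans h h'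
  trans_right _ h' h'' _ := le_trans h' h''
  antisymm h h' := pos_injective (le_antisymm h h')

namespace PathAlgebra

variable {K : Type u} [Field K] {n : ℕ}

/-- The sum of the coefficients of a linear combination of paths. -/
noncomputable def coeffSum (a b : LinearQuiver n) : (Quiver.Path a b →₀ K) →ₗ[K] K :=
  Finsupp.lsum K fun _ => LinearMap.id

theorem coeffSum_single {a b : LinearQuiver n} (p : Quiver.Path a b) (x : K) :
    coeffSum a b (Finsupp.single p x) = x := by
  simp [coeffSum]

theorem coeffSum_concat {a b c : LinearQuiver n} (x : Quiver.Path a b →₀ K)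
    (y : Quiver.Path b c →₀ K) :
    coeffSum a c (concat K a b c x y) = coeffSum a b x * coeffSum b c y := by
  induction x using Finsupp.induction_linear with
  | zero => simp
  | add f g hf hg => simp [hf, hg, add_mul]
  | single p r =>
    induction y using Finsupp.induction_linear with
    | zero => simp
    | add f g hf hg => simp [hf, hg, mul_add]
    | single q s => simp only [concat_single_single, coeffSum_single]

theorem coeffSum_injective (a b : LinearQuiver n) :
    Function.Injective (coeffSum (K := K) a b) := by
  rw [injective_iff_map_eq_zero]
  intro x hx
  ext p
  have h : x = Finsupp.single p (x p) := by
    ext q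
    rw [Subsingleton.elim q p, Finsupp.single_eq_same]
  rw [h, coeffSum_single] at hx
  rw [hx, Finsupp.zero_apply]

theorem eq_zero_of_not_pathRel {a b : LinearQuiver n} (h : ¬ pathRel n a b)
    (x : Quiver.Path a b →₀ K) : x = 0 := by
  ext p
  exact absurd (pos_le_of_path p) h

variable (K n) in
/-- The path algebra of the linear quiver is the algebra of upper triangular matrices, because
there is at most one path between two vertices. -/
noncomputable def toThin : PathAlgebra K (LinearQuiver n) →+* ThinAlgebra K (pathRel n) where
  toFun x := ThinAlgebra.mk (fun a b => coeffSum a b (x a b)) fun a b h => by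
    rw [eq_zero_of_not_pathRel h (x a b), map_zero]
  map_one' := by
    ext a b
    rw [ThinAlgebra.mk_apply, ThinAlgebra.one_apply]
    by_cases h : a = b
    · subst h
      rw [one_apply_self, coeffSum_single, if_pos ⟨rfl, le_refl _⟩]
    · rw [one_apply_ne h, map_zero, if_neg fun h' => h h'.1]
  map_mul' x y := (ThinAlgebra.mul_ext fun a c _ => by
    simp only [ThinAlgebra.mk_apply, mul_apply, map_sum, coeffSum_concat]).symm
  map_zero' := by
    ext a b
    rw [ThinAlgebra.mk_apply, zero_apply, map_zero, ThinAlgebra.zero_apply]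
  map_add' x y := by
    ext a b
    rw [ThinAlgebra.mk_apply, add_apply, map_add]
    rfl

theorem toThin_apply (x : PathAlgebra K (LinearQuiver n)) (a b : LinearQuiver n) :
    toThin K n x a b = coeffSum a b (x a b) := rfl

theorem toThin_bijective : Function.Bijective (toThin K n) := by
  classical
  constructor
  · intro x y h
    funext a b
    exact coeffSum_injective a b (congrArg (fun f => f a b) h)
  · intro f
    refine ⟨fun a b => if h : pathRel n a b then
      Finsupp.single (Classical.choice (nonempty_path (show a.pos ≤ b.pos from h))) (f a b)
      else 0, ?_⟩
    ext a b
    change coeffSum a b (dite _ _ _) = _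
    by_cases h : pathRel n a b
    · rw [dif_pos h, coeffSum_single]
    · rw [dif_neg h, map_zero, f.apply_eq_zero h]

theorem toThin_surjective : Function.Surjective (toThin K n) := toThin_bijective.2

theorem toThin_algebraMap (c : K) :
    toThin K n (algebraMap K _ c) = algebraMap K _ c := by
  rw [Algebra.algebraMap_eq_smul_one, Algebra.algebraMap_eq_smul_one, ← map_one (toThin K n)]
  ext a b
  rw [toThin_apply, smul_apply, map_smul, ThinAlgebra.smul_apply, toThin_apply, smul_eq_mul]

/-- The thin modules as modules over the path algebra. -/
noncomputable instance (S : LinearQuiver n → Prop) [IsThinSupport (pathRel n) S] :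
    Module (PathAlgebra K (LinearQuiver n)) (ThinModule K S) :=
  Module.compHom _ (toThin K n)

theorem smul_thinModule {S : LinearQuiver n → Prop} [IsThinSupport (pathRel n) S]
    (x : PathAlgebra K (LinearQuiver n)) (u : ThinModule K S) : x • u = toThin K n x • u := rfl

end PathAlgebra

/-! ### Interval modules over the path algebra of the linear quiver -/

/-- A `B`-linear map is `H`-linear if `H` acts on both modules through a map `ψ : H → B`. Only the
action matters, so `ψ` may be any section of a surjective ring homomorphism. -/
def LinearMap.ofSMulEq {B H X Y : Type*} [Ring B] [Ring H] [AddCommGroup X] [AddCommGroup Y]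
    [Module B X] [Module B Y] [Module H X] [Module H Y] (ψ : H → B)
    (hX : ∀ (h : H) (x : X), h • x = ψ h • x) (hY : ∀ (h : H) (y : Y), h • y = ψ h • y)
    (f : X →ₗ[B] Y) : X →ₗ[H] Y where
  toFun := f
  map_add' := map_add f
  map_smul' h x := by rw [hX, map_smul, RingHom.id_apply, hY]

/-- The support of the interval module at the vertex `(a, b)` of the Auslander algebra: the
vertices at the positions `a - 1, …, b - 2`, counted from `0`. -/
def interval {n : ℕ} (x : Grid n) (v : LinearQuiver n) : Prop :=
  x.1.val ≤ v.pos + 1 ∧ v.pos + 1 < x.2.val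

instance {n : ℕ} (x : Grid n) : IsThinSupport (pathRel n) (interval x) where
  refl _ := le_refl _
  trans h h' h'' h''' := by simp only [interval, pathRel] at *; omega

namespace ThinModule

open ThinAlgebra PathAlgebra

variable {K : Type u} [Field K] {n : ℕ}

theorem exists_isGenerator_interval {x : Grid n} (hx : auslanderRel n x x) :
    ∃ g, IsGenerator (pathRel n) (interval x) g ∧ g.pos + 2 = x.2.val := by
  simp only [auslanderRel] at hx
  obtain ⟨g, hg⟩ := exists_pos_eq (n := n) (k := x.2.val - 2) (by omega)
  refine ⟨g, ⟨?_, fun y hy => ?_⟩, by omega⟩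
  · simp only [interval]; omega
  · simp only [interval, pathRel] at *; omega

/-- A homomorphism between interval modules can only be nonzero if the corresponding vertices of
the Auslander algebra are related: its image is a quotient of the source, which cuts off the lower
end, and a submodule of the target, which cuts off the upper end. -/
theorem auslanderRel_of_hom_ne_zero {x y : Grid n} (hx : auslanderRel n x x)
    (hy : auslanderRel n y y)
    {F : ThinModule K (interval x) →ₗ[ThinAlgebra K (pathRel n)] ThinModule K (interval y)}
    (h : F ≠ 0) : auslanderRel n x y := by
  obtain ⟨g, hg, hgx⟩ := exists_isGenerator_interval hx
  have h1 := mem_of_hom_ne_zero hg h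
  have h2 : x.1.val ≤ y.1.val := by
    by_contra hlt
    simp only [auslanderRel, interval] at *
    obtain ⟨z, hz⟩ := exists_pos_eq (n := n) (k := y.1.val - 1) (by omega)
    have h3 := mem_of_rel_of_hom_ne_zero hg h (z := z) (by simp only [interval]; omega)
      (by simp only [pathRel]; omega)
    simp only [interval] at h3; omega
  simp only [auslanderRel, interval] at *
  omega

section Decomposition

variable {X : Type*} [AddCommGroup X] [Module (ThinAlgebra K (pathRel n)) X] [Module K X]
  [IsScalarTower K (ThinAlgebra K (pathRel n)) X]

/-- Every nonzero module over the path algebra has an interval module as a direct summand. For `p`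
minimal in the support and `k` maximal such that `X_k → X_p` is nonzero, any element of `X_k` with
nonzero image generates one. -/
theorem exists_retract_interval [Nontrivial X] :
    ∃ (x : Grid n) (_ : auslanderRel n x x)
      (f : ThinModule K (interval x) →ₗ[ThinAlgebra K (pathRel n)] X)
      (g : X →ₗ[ThinAlgebra K (pathRel n)] ThinModule K (interval x)),
      g ∘ₗ f = LinearMap.id := by
  classical
  have hp : ∃ p : ℕ, ∃ a : LinearQuiver n, a.pos = p ∧
      ∃ v : X, e K (pathRel n) a a • v ≠ 0 := by
    obtain ⟨v, hv⟩ := exists_ne (0 : X)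
    obtain ⟨x, hx⟩ := exists_e_smul_ne_zero (K := K) (R := pathRel n) hv
    exact ⟨_, x, rfl, v, hx⟩
  obtain ⟨p, hpx, hpv⟩ := Nat.find_spec hp
  have hpmin : ∀ a : LinearQuiver n, a.pos < p.pos → ∀ v : X,
      e K (pathRel n) a a • v = 0 := by
    intro a ha v
    by_contra hv
    exact Nat.find_min hp (hpx ▸ ha) ⟨a, rfl, v, hv⟩
  obtain ⟨k, hk, hkmax⟩ := Finset.exists_max_image
    (Finset.univ.filter fun k : LinearQuiver n => ∃ v : X, e K (pathRel n) p k • v ≠ 0)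
    pos ⟨p, by simpa using hpv⟩
  obtain ⟨v, hv⟩ := (Finset.mem_filter.1 hk).2
  have hkmax' : ∀ d : LinearQuiver n, k.pos < d.pos → ∀ w : X,
      e K (pathRel n) p d • w = 0 := by
    intro d hd w
    by_contra hw
    have := hkmax d (by simpa using ⟨w, hw⟩)
    omega
  have hpk : pathRel n p k := by
    by_contra h
    exact hv (by rw [e_eq_zero h, zero_smul])
  have hpn := p.pos_lt
  have hkn := k.pos_lt
  let x : Grid n := (⟨p.pos + 1, by omega⟩, ⟨k.pos + 2, by omega⟩)
  have hx : auslanderRel n x x := by simp only [pathRel, auslanderRel, x] at *; omega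
  have hmem : ∀ a, interval x a ↔ p.pos ≤ a.pos ∧ a.pos ≤ k.pos := by
    intro a; simp only [interval, x]; omega
  have hgen : IsGenerator (pathRel n) (interval x) k :=
    ⟨(hmem k).2 ⟨hpk, le_refl _⟩, fun a ha => ((hmem a).1 ha).2⟩
  have hkill : ∀ a, ¬ interval x a → e K (pathRel n) a k • v = 0 := by
    intro a ha
    by_cases hR : pathRel n a k
    · rw [← e_self_mul_e, mul_smul, hpmin a]
      rw [hmem] at ha
      simp only [pathRel] at hR; omega
    · rw [e_eq_zero hR, zero_smul]
  have hcokill : ∀ a, ¬ interval x a → ∀ w : X, e K (pathRel n) p a • w = 0 := by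
    intro a ha w
    by_cases hR : pathRel n p a
    · refine hkmax' a ?_ w
      rw [hmem] at ha
      simp only [pathRel] at hR; omega
    · rw [e_eq_zero hR, zero_smul]
  obtain ⟨l, hl⟩ : ∃ l : X →ₗ[K] K, l (e K (pathRel n) p k • v) = 1 := by
    obtain ⟨l, hl⟩ := not_forall.1 fun h => hv ((Module.forall_dual_apply_eq_zero_iff K _).1 h)
    exact ⟨(l (e K (pathRel n) p k • v))⁻¹ • l, by
      rw [LinearMap.smul_apply, smul_eq_mul, inv_mul_cancel₀ hl]⟩
  have hsocle : ∀ a, interval x a → pathRel n p a := fun a ha => ((hmem a).1 ha).1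
  refine ⟨x, hx, lift hgen v hkill, colift hsocle l
    fun a ha w => by rw [hcokill a ha w, map_zero], ?_⟩
  ext1 u
  rw [LinearMap.comp_apply, colift_lift, LinearMap.id_apply]
  exact (congrArg (· • u) hl).trans (one_smul K u)

end Decomposition

theorem indecomposable_interval {x : Grid n} (hx : auslanderRel n x x) :
    Indecomposable
      (ModuleCat.of (PathAlgebra K (LinearQuiver n)) (ThinModule K (interval x))) := by
  obtain ⟨g, hg, -⟩ := exists_isGenerator_interval hx
  have : Nontrivial (ThinModule K (interval x)) := ⟨_, _, basisVec_ne_zero hg.1⟩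
  refine indecomposable_of_idempotent _ fun f hf => ?_
  obtain ⟨F, hF⟩ : ∃ F : ThinModule K (interval x) →ₗ[ThinAlgebra K (pathRel n)]
      ThinModule K (interval x), ∀ u, F u = f u :=
    ⟨LinearMap.ofSMulEq (Function.surjInv toThin_surjective)
      (fun b u => by rw [smul_thinModule, Function.surjInv_eq toThin_surjective])
      (fun b u => by rw [smul_thinModule, Function.surjInv_eq toThin_surjective]) f, fun _ => rfl⟩
  rcases idempotent_eq_zero_or_id hg F (by
    ext1 u; simpa [hF] using congrArg (fun G => G u) hf) with h | h
  · left; ext1 u; rw [← hF, h]; rfl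
  · right; ext1 u; rw [← hF, h]; rfl

theorem exists_iso_interval (Y : ModuleCat.{u} (PathAlgebra K (LinearQuiver n)))
    (hY : Indecomposable Y) : ∃ x : Grid n, auslanderRel n x x ∧
      Nonempty (Y ≅ ModuleCat.of (PathAlgebra K (LinearQuiver n)) (ThinModule K (interval x))) := by
  let E : PathAlgebra K (LinearQuiver n) ≃+* ThinAlgebra K (pathRel n) :=
    RingEquiv.ofBijective (toThin K n) toThin_bijective
  let _ : Module (ThinAlgebra K (pathRel n)) Y := Module.compHom Y E.symm.toRingHom
  have hsmul : ∀ (h : PathAlgebra K (LinearQuiver n)) (y : Y), h • y = toThin K n h • y := by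
    intro h y
    change h • y = E.symm (E h) • y
    rw [E.symm_apply_apply]
  let _ : Module K Y := Module.restrictScalars K (ThinAlgebra K (pathRel n)) Y
  have : IsScalarTower K (ThinAlgebra K (pathRel n)) Y := IsScalarTower.restrictScalars K _ Y
  have : Nontrivial Y := by
    rw [← not_subsingleton_iff_nontrivial]
    exact fun h => hY.1 (ModuleCat.isZero_of_subsingleton Y)
  obtain ⟨x, hx, f, g, hgf⟩ := exists_retract_interval (K := K) (n := n) (X := Y)
  obtain ⟨s, hs, -⟩ := exists_isGenerator_interval hx
  have : Nontrivial (ThinModule K (interval x)) := ⟨_, _, basisVec_ne_zero hs.1⟩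
  refine ⟨x, hx, hY.nonempty_iso_of_retract _
    (LinearMap.ofSMulEq (toThin K n) (fun _ _ => rfl) hsmul f)
    (LinearMap.ofSMulEq (toThin K n) hsmul (fun _ _ => rfl) g) ?_⟩
  exact LinearMap.ext fun u => congrArg (fun F => F u) hgf

end ThinModule

/-! ### The endomorphism algebra of the sum of all interval modules -/

namespace ThinModule

open ThinAlgebra PathAlgebra

variable {K : Type u} [Field K] {n s : ℕ}

/-- The sum of all interval modules. -/
abbrev IntervalSum (K : Type u) [Field K] (g : Fin s ≃ {x : Grid n // auslanderRel n x x}) :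
    Type u :=
  ∀ l, ThinModule K (interval (g l).1)

variable (g : Fin s ≃ {x : Grid n // auslanderRel n x x})

open Classical in
/-- The canonical map between interval modules; it is set to `0` if the corresponding vertices are
not related. -/
noncomputable def intervalMap (K : Type u) [Field K] (x y : Grid n) :
    ThinModule K (interval x) →ₗ[ThinAlgebra K (pathRel n)] ThinModule K (interval y) :=
  if h : auslanderRel n x y then
    restrict K fun v w hv hw hvw => by
      simp only [auslanderRel, interval, pathRel] at *; omega
  else 0

theorem intervalMap_apply {x y : Grid n} (h : auslanderRel n x y) (u : ThinModule K (interval x))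
    {v : LinearQuiver n} (hv : interval y v) : intervalMap K x y u v = u v := by
  rw [intervalMap, dif_pos h, restrict_apply _ _ hv]

/-- The endomorphism of the sum of all interval modules with given coefficients. -/
noncomputable def intervalEnd (f : AuslanderAlg K n) :
    IntervalSum K g →ₗ[ThinAlgebra K (pathRel n)] IntervalSum K g :=
  LinearMap.pi fun j => ∑ i, f (g i) (g j) • (intervalMap K (g i).1 (g j).1 ∘ₗ LinearMap.proj i)

theorem intervalEnd_apply (f : AuslanderAlg K n) (u : IntervalSum K g) (j : Fin s)
    {v : LinearQuiver n} (hv : interval (g j).1 v) :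
    intervalEnd g f u j v = ∑ i, f (g i) (g j) * u i v := by
  simp only [intervalEnd, LinearMap.pi_apply, LinearMap.sum_apply, LinearMap.smul_apply,
    LinearMap.comp_apply, LinearMap.proj_apply, ThinModule.sum_apply, ThinModule.smul_apply]
  refine Finset.sum_congr rfl fun i _ => ?_
  by_cases h : auslanderRel n (g i).1 (g j).1
  · rw [intervalMap_apply h _ hv]
  · rw [ThinAlgebra.apply_eq_zero f h, zero_mul, zero_mul]

theorem sum_grid_eq_sum {F : Grid n → K} (hF : ∀ x, ¬ auslanderRel n x x → F x = 0) :
    ∑ x, F x = ∑ i, F (g i).1 := by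
  classical
  rw [Equiv.sum_comp g fun x => F x.1, ← Finset.sum_filter_of_ne (p := fun x => auslanderRel n x x)
    fun x _ hx => by_contra fun h => hx (hF x h)]
  exact Finset.sum_subtype _ (by simp) F

theorem intervalEnd_mul (f h : AuslanderAlg K n) :
    intervalEnd g (f * h) = intervalEnd g h ∘ₗ intervalEnd g f := by
  refine LinearMap.ext fun u => ?_
  ext j v hv
  rw [LinearMap.comp_apply, intervalEnd_apply g _ _ _ hv, intervalEnd_apply g _ _ _ hv]
  have h1 : ∀ i, (f * h) (g i) (g j) * u i v =
      ∑ k, f (g i) (g k) * h (g k) (g j) * u i v := by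
    intro i
    by_cases hi : interval (g i).1 v
    · by_cases hij : auslanderRel n (g i).1 (g j).1
      · rw [mul_apply_of_rel _ _ hij, sum_grid_eq_sum g, Finset.sum_mul]
        intro x hx
        rw [ThinAlgebra.apply_eq_zero h fun h' => hx (IsThinRel.refl_left h'), mul_zero]
      · rw [ThinAlgebra.apply_eq_zero _ hij, zero_mul, eq_comm]
        refine Finset.sum_eq_zero fun k _ => ?_
        by_contra hne
        obtain ⟨hf, hh⟩ := mul_ne_zero_iff.1 (mul_ne_zero_iff.1 hne).1
        have h1 := rel_of_apply_ne_zero hf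
        have h2 := rel_of_apply_ne_zero hh
        simp only [auslanderRel, interval] at *; omega
    · simp [ThinModule.apply_eq_zero (u i) hi]
  have h2 : ∀ k, h (g k) (g j) * intervalEnd g f u k v =
      ∑ i, f (g i) (g k) * h (g k) (g j) * u i v := by
    intro k
    by_cases hk : interval (g k).1 v
    · rw [intervalEnd_apply g _ _ _ hk, Finset.mul_sum]
      exact Finset.sum_congr rfl fun i _ => by ring
    · rw [ThinModule.apply_eq_zero _ hk, mul_zero, eq_comm]
      refine Finset.sum_eq_zero fun i _ => ?_
      by_contra hne
      obtain ⟨hfh, hu⟩ := mul_ne_zero_iff.1 hne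
      obtain ⟨hf, hh⟩ := mul_ne_zero_iff.1 hfh
      have h1 := rel_of_apply_ne_zero hf
      have h2 := rel_of_apply_ne_zero hh
      have hi : interval (g i).1 v := by
        by_contra hi
        exact hu (ThinModule.apply_eq_zero _ hi)
      simp only [auslanderRel, interval] at *; omega
  simp only [h1, h2]
  exact Finset.sum_comm

theorem intervalEnd_algebraMap (c : K) (u : IntervalSum K g) :
    intervalEnd g (algebraMap K _ c) u = c • u := by
  ext j v hv
  rw [intervalEnd_apply g _ _ _ hv, Finset.sum_eq_single j]
  · rw [Algebra.algebraMap_eq_smul_one, ThinAlgebra.smul_apply, ThinAlgebra.one_apply,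
      if_pos ⟨rfl, (g j).2⟩, mul_one]
    rfl
  · intro i _ hi
    rw [Algebra.algebraMap_eq_smul_one, ThinAlgebra.smul_apply, ThinAlgebra.one_apply,
      if_neg fun h => hi (g.injective (Subtype.ext h.1)), mul_zero, zero_mul]
  · simp

theorem intervalEnd_injective : Function.Injective (intervalEnd (K := K) g) := by
  intro f h hfh
  ext x y
  by_cases hxy : auslanderRel n x y
  · obtain ⟨i, hi⟩ := g.surjective ⟨x, IsThinRel.refl_left hxy⟩
    obtain ⟨j, hj⟩ := g.surjective ⟨y, IsThinRel.refl_right hxy⟩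
    have hi' : (g i).1 = x := by rw [hi]
    have hj' : (g j).1 = y := by rw [hj]
    subst hi' hj'
    have hy2 := (g j).1.2.2
    obtain ⟨v, hv⟩ := LinearQuiver.exists_pos_eq (n := n) (k := (g j).1.1.val - 1) (by
      simp only [auslanderRel] at hxy; omega)
    have hxy' := hxy
    simp only [auslanderRel] at hxy'
    have hvi : interval (g i).1 v := by simp only [interval]; omega
    have hvj : interval (g j).1 v := by simp only [interval]; omega
    have key : ∀ f : AuslanderAlg K n,
        intervalEnd g f (Pi.single i (basisVec K _ v)) j v = f (g i) (g j) := by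
      intro f
      rw [intervalEnd_apply g _ _ _ hvj, Finset.sum_eq_single i]
      · rw [Pi.single_eq_same, basisVec_apply_self hvi, mul_one]
      · intro l _ hl
        rw [Pi.single_eq_of_ne hl, zero_apply, mul_zero]
      · simp
    rw [← key f, ← key h, hfh]
  · rw [ThinAlgebra.apply_eq_zero f hxy, ThinAlgebra.apply_eq_zero h hxy]

theorem intervalEnd_surjective : Function.Surjective (intervalEnd (K := K) g) := by
  classical
  intro G
  choose a ha _ using fun i => exists_isGenerator_interval (n := n) (g i).2
  let C : ∀ i j, ThinModule K (interval (g i).1) →ₗ[ThinAlgebra K (pathRel n)]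
      ThinModule K (interval (g j).1) := fun i j => LinearMap.proj j ∘ₗ G ∘ₗ
    LinearMap.single _ (fun l => ThinModule K (interval (g l).1)) i
  let f : AuslanderAlg K n := ThinAlgebra.mk (fun x y =>
    if h : auslanderRel n x y then
      C (g.symm ⟨x, IsThinRel.refl_left h⟩) (g.symm ⟨y, IsThinRel.refl_right h⟩)
        (basisVec K _ (a (g.symm ⟨x, IsThinRel.refl_left h⟩)))
        (a (g.symm ⟨x, IsThinRel.refl_left h⟩))
    else 0) fun x y h => dif_neg h
  have hf : ∀ i j, f (g i) (g j) = C i j (basisVec K _ (a i)) (a i) := by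
    intro i j
    by_cases h : auslanderRel n (g i).1 (g j).1
    · have h1 : g.symm ⟨(g i).1, IsThinRel.refl_left h⟩ = i := g.symm_apply_apply i
      have h2 : g.symm ⟨(g j).1, IsThinRel.refl_right h⟩ = j := g.symm_apply_apply j
      simp only [f, ThinAlgebra.mk_apply, dif_pos h]
      rw [h1, h2]
    · rw [ThinAlgebra.apply_eq_zero f h]
      by_cases hC : C i j = 0
      · rw [hC]; rfl
      · exact absurd (auslanderRel_of_hom_ne_zero (g i).2 (g j).2 hC) h
  refine ⟨f, LinearMap.ext fun u => ?_⟩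
  ext j v hv
  rw [intervalEnd_apply g _ _ _ hv]
  have hu : G u j = ∑ i, C i j (u i) := by
    conv_lhs => rw [← Finset.univ_sum_single u, map_sum, Finset.sum_apply]
    rfl
  rw [hu, ThinModule.sum_apply]
  refine Finset.sum_congr rfl fun i _ => ?_
  rw [hom_thin_apply (ha i), if_pos hv, hf]

variable (K) in
/-- Endomorphisms over the path algebra and over the algebra of upper triangular matrices are the
same. -/
noncomputable def endEquiv : Module.End (ThinAlgebra K (pathRel n)) (IntervalSum K g) ≃+*
    Module.End (PathAlgebra K (LinearQuiver n)) (IntervalSum K g) where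
  toFun f := LinearMap.ofSMulEq (toThin K n) (fun _ _ => rfl) (fun _ _ => rfl) f
  invFun f := LinearMap.ofSMulEq (Function.surjInv toThin_surjective)
    (fun b u => funext fun l => by
      rw [Pi.smul_apply, Pi.smul_apply, smul_thinModule, Function.surjInv_eq toThin_surjective])
    (fun b u => funext fun l => by
      rw [Pi.smul_apply, Pi.smul_apply, smul_thinModule, Function.surjInv_eq toThin_surjective]) f
  left_inv _ := rfl
  right_inv _ := rfl
  map_mul' _ _ := rfl
  map_add' _ _ := rfl

variable (K) in
/-- The thin algebra on the grid is the opposite of the endomorphism algebra of the sum of all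
interval modules. -/
noncomputable def auslanderEquiv : AuslanderAlg K n ≃+*
    (Module.End (PathAlgebra K (LinearQuiver n)) (IntervalSum K g))ᵐᵒᵖ :=
  RingEquiv.ofBijective
    ({ toFun := fun f => MulOpposite.op (endEquiv K g (intervalEnd g f))
       map_one' := by
        rw [← map_one (algebraMap K (AuslanderAlg K n))]
        refine congrArg MulOpposite.op (LinearMap.ext fun u => ?_)
        exact (intervalEnd_algebraMap g 1 u).trans (one_smul K u)
       map_mul' := fun f h => by
        rw [← MulOpposite.op_mul, ← map_mul, intervalEnd_mul]
        rfl
       map_zero' := by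
        rw [← map_zero (algebraMap K (AuslanderAlg K n))]
        refine congrArg MulOpposite.op (LinearMap.ext fun u => ?_)
        exact (intervalEnd_algebraMap g 0 u).trans (zero_smul K u)
       map_add' := fun f h => by
        rw [← MulOpposite.op_add, ← map_add]
        congr 2
        refine LinearMap.ext fun u => ?_
        ext j v hv
        rw [LinearMap.add_apply, Pi.add_apply, ThinModule.add_apply, intervalEnd_apply g _ _ _ hv,
          intervalEnd_apply g _ _ _ hv, intervalEnd_apply g _ _ _ hv, ← Finset.sum_add_distrib]
        exact Finset.sum_congr rfl fun i _ => by rw [ThinAlgebra.add_apply, add_mul] } :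
      AuslanderAlg K n →+* _)
    ⟨fun _ _ h => intervalEnd_injective g ((endEquiv K g).injective (MulOpposite.op_injective h)),
      fun F => by
        obtain ⟨f, hf⟩ := intervalEnd_surjective g ((endEquiv K g).symm F.unop)
        refine ⟨f, ?_⟩
        change MulOpposite.op (endEquiv K g (intervalEnd g f)) = F
        rw [hf, RingEquiv.apply_symm_apply, MulOpposite.op_unop]⟩

theorem finite_thinModule (S : LinearQuiver n → Prop) [IsThinSupport (pathRel n) S] :
    Module.Finite (PathAlgebra K (LinearQuiver n)) (ThinModule K S) := by
  have : IsScalarTower K (PathAlgebra K (LinearQuiver n)) (ThinModule K S) :=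
    ⟨fun c h u => by
      rw [smul_thinModule, smul_thinModule, Algebra.smul_def, map_mul, toThin_algebraMap,
        ← Algebra.smul_def, smul_assoc]⟩
  exact Module.Finite.of_restrictScalars_finite K _ _

theorem auslanderRel_of_iso_interval {x y : Grid n} (hx : auslanderRel n x x)
    (hy : auslanderRel n y y)
    (E : ModuleCat.of (PathAlgebra K (LinearQuiver n)) (ThinModule K (interval x)) ≅
      ModuleCat.of (PathAlgebra K (LinearQuiver n)) (ThinModule K (interval y))) :
    auslanderRel n x y := by
  obtain ⟨g, hg, -⟩ := exists_isGenerator_interval hx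
  refine auslanderRel_of_hom_ne_zero (K := K) hx hy
    (F := LinearMap.ofSMulEq (Function.surjInv toThin_surjective)
      (fun b u => by rw [smul_thinModule, Function.surjInv_eq toThin_surjective])
      (fun b u => by rw [smul_thinModule, Function.surjInv_eq toThin_surjective]) E.hom.hom) ?_
  intro h
  refine basisVec_ne_zero (K := K) hg.1 (E.toLinearEquiv.injective ?_)
  rw [map_zero]
  exact congrArg (fun F => F (basisVec K (interval x) g)) h

theorem isAuslanderAlgebra (K : Type u) [Field K] (n : ℕ) :
    IsAuslanderAlgebra K (PathAlgebra K (LinearQuiver n)) (AuslanderAlg K n) := by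
  classical
  let g : Fin (Fintype.card {x : Grid n // auslanderRel n x x}) ≃ {x // auslanderRel n x x} :=
    (Fintype.equivFin _).symm
  refine ⟨_, fun i => ModuleCat.of _ (ThinModule K (interval (g i).1)), fun i => ?_,
    fun i => indecomposable_interval (g i).2, fun i j ⟨E⟩ => ?_, fun Y _ hY => ?_,
    auslanderEquiv K g, fun c u => ?_⟩
  · exact finite_thinModule _
  · exact g.injective (Subtype.ext (IsThinRel.antisymm
      (auslanderRel_of_iso_interval (g i).2 (g j).2 E)
      (auslanderRel_of_iso_interval (g j).2 (g i).2 E.symm)))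
  · obtain ⟨x, hx, hE⟩ := exists_iso_interval Y hY
    obtain ⟨i, hi⟩ := g.surjective ⟨x, hx⟩
    have hi' : (g i).1 = x := by rw [hi]
    subst hi'
    exact ⟨i, hE⟩
  · change intervalEnd g (algebraMap K _ c) u = _
    rw [intervalEnd_algebraMap]
    funext l
    change c • u l = toThin K n (algebraMap K _ c) • u l
    rw [toThin_algebraMap, algebraMap_smul]

end ThinModule

theorem mainTheorem2 (K : Type u) [Field K] [IsAlgClosed K] (m : ℕ) (hm : 0 < m) :
    ∃ (A : Type u) (_ : Ring A) (_ : Algebra K A),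
      Module.Finite K A ∧ IsBasicAlgebra A ∧
      IsAuslanderAlgebra K (PathAlgebra K (LinearQuiver (3 * m - 1))) A ∧
      ∃ (t : ℕ) (θ : Fin t → ModuleCat.{u} A) (ord : LinearOrder (Fin t)),
        IsStratifyingSystem θ ord ∧
        IsTwoClusterTilting (ModuleCat.of A (∀ i, θ i)) ∧
        (∀ i j, EndQuiverArrow θ i j → ord.lt i j) ∧
        6 * t = (3 * m - 1) * ((3 * m - 1) + 1) * ((3 * m - 1) + 2) ∧
        Module.Free ℤ (GrothendieckK0 A) ∧ Module.Finite ℤ (GrothendieckK0 A) ∧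
        2 * Module.finrank ℤ (GrothendieckK0 A) = (3 * m - 1) * ((3 * m - 1) + 1) ∧
        m * Module.finrank ℤ (GrothendieckK0 A) < t := by
  classical
  obtain ⟨n, hn⟩ : ∃ n, n = 3 * m - 1 := ⟨_, rfl⟩
  rw [← hn]
  let c : Fin (Fintype.card (Triple n)) ≃ Triple n := (Fintype.equivFin _).symm
  -- Arrows of the grid go weakly up in both coordinates, so their sum is a rank function.
  let E : GrothendieckK0 (AuslanderAlg K n) ≃ₗ[ℤ] ({x // auslanderRel n x x} → ℤ) :=
    (ThinAlgebra.k0Equiv K (auslanderRel n) (rk := fun x => x.1.val + x.2.val)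
      fun x y hxy hne => by
        simp only [auslanderRel] at hxy
        by_contra hlt
        exact hne (Prod.ext (Fin.ext (by omega)) (Fin.ext (by omega)))).toIntLinearEquiv
  have hrank : Module.finrank ℤ (GrothendieckK0 (AuslanderAlg K n)) =
      Fintype.card {x // auslanderRel n x x} := by
    rw [E.finrank_eq, Module.finrank_fintype_fun_eq_card]
  have h1 := card_triple n
  have h2 := card_vertices n
  refine ⟨AuslanderAlg K n, inferInstance, inferInstance, inferInstance,
    ThinAlgebra.isBasicAlgebra K _, ThinModule.isAuslanderAlgebra K n, _,
    ThinModule.cellFamily K c, ThinModule.lexOrder c, ThinModule.isStratifyingSystem c,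
    ThinModule.isTwoClusterTilting c, fun i j => ThinModule.lexOrder_lt_of_endQuiverArrow c, h1,
    Module.Free.of_equiv E.symm, Module.Finite.equiv E.symm, ?_, ?_⟩
  · rw [hrank, h2]
  · rw [hrank]
    have h3 : n + 2 = 3 * m + 1 := by omega
    have h4 : 0 < n := by omega
    have h5 : 6 * Fintype.card (Triple n) = n * (n + 1) * (3 * m + 1) := by rw [h1, h3]
    have h6 : 0 < n * (n + 1) := Nat.mul_pos h4 (Nat.succ_pos n)
    have h7 : 2 * (m * Fintype.card {x // auslanderRel n x x}) = m * (n * (n + 1)) := by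
      rw [← h2]; ring
    have h8 : n * (n + 1) * (3 * m + 1) = 3 * (m * (n * (n + 1))) + n * (n + 1) := by ring
    omega
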